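/- Let $h\in\{1,5\}$ and $d_2\in\{0,2,4,\dots,58\}$, and for odd primes $p$ put $$d_p=\frac{p^2(p^4-1)}{60}\,d_2+\frac{p^2(p^2-1)(p^2-4)}{360}\,h^2 .$$ Give the ring $\mathbf{Z}[x]/(x^4)$ the filtration in which $x$ has some fixed positive filtration $e$, i.e. the $n$-th filtration ideal is generated by the $x^k$ with $ek\ge n$. There is exactly one filtered $\lambda$-ring structure on $\mathbf{Z}[x]/(x^4)$ (a $\lambda$-ring structure whose operations $\lambda^i$, $i>0$, preserve the filtration ideals) with Adams operations $$\psi^p(x)=p^2x+h\,\frac{p^2(p^2-1)}{12}\,x^2+d_px^3\qquad\text{for all primes }p;$$ it is denoted by $S(h,d_2)$. For a $\lambda$-ring $R$, let $H^0_\lambda(R)$ be the algebra (under composition) of those $\mathbf{Z}$-linear endomorphisms $f$ of $R$ such that $f(r)^p\equiv f(r^p)\pmod{pR}$ for all primes $p$ and all $r\in R$, and $\psi^m f=f\psi^m$ for all $m\ge 1$; this is the $0$-th $\lambda$-ring cohomology of $R$. Then for each of the $60$ filtered $\lambda$-rings $S(h,d_2)$, with respect to the basis $\{1,x,x^2,x^3\}$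 (columns are the images of the basis elements), $H^0_\lambda(S(h,d_2))$ is the subalgebra of $M(4,\mathbf{Z})$ consisting of all integer matrices of the form $$\begin{bmatrix} a&0&0&0\\ 0&j&0&0\\ 0&k&r&0\\ 0&l&s&w\end{bmatrix}$$ such that: 1. if $h=1$, then $r=j+12k$, $\;(6d_2+1)s=(8-12d_2)k+60l$, and $w=6s+j+12k$; 2. if $h=5$, then $k\equiv 0\pmod 5$, $\;r=j+\frac{12k}{5}$, $\;(6d_2+25)s=(200-12d_2)k+300l$, and $(6d_2+25)w=(6d_2+25)j+300k+360l$. In each of the $60$ cases the algebra $H^0_\lambda(S(h,d_2))$ is commutative and, as an additive group, is free of rank $4$ over $\mathbf{Z}$. -/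

import Mathlib

open Polynomial

/-! ### The universal polynomials of the theory of `λ`-rings -/

/-- The coefficient of `t ^ n` in `∏_{m, k = 1}^n (1 + ξ_m η_k t)`, a polynomial in the
variables `ξ_m = X (inl m)` and `η_k = X (inr k)`. -/
noncomputable def mulCoeff (n : ℕ) : MvPolynomial (Fin n ⊕ Fin n) ℤ :=
  (∏ m : Fin n, ∏ k : Fin n,
    (1 + C (MvPolynomial.X (Sum.inl m) * MvPolynomial.X (Sum.inr k)) * X) :
      (MvPolynomial (Fin n ⊕ Fin n) ℤ)[X]).coeff n

/-- The coefficient of `t ^ i` in `∏_{l_1 < ⋯ < l_j} (1 + ξ_{l_1} ⋯ ξ_{l_j} t)`, where there are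
`i * j` variables `ξ_l`. -/
noncomputable def compCoeff (i j : ℕ) : MvPolynomial (Fin (i * j)) ℤ :=
  (∏ s ∈ (Finset.univ : Finset (Fin (i * j))).powersetCard j,
    (1 + C (∏ l ∈ s, MvPolynomial.X l) * X) : (MvPolynomial (Fin (i * j)) ℤ)[X]).coeff i

lemma exists_prod_one_add_mul {S : Type*} [CommRing S] (n : ℕ) (x : S[X]) (y : Fin n → S[X]) :
    ∏ k : Fin n, (1 + x * y k) =
      1 + ∑ k : Fin n, (∑ t ∈ Finset.powersetCard (k.val + 1) Finset.univ, ∏ i ∈ t, y i) *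
        x ^ (k.val + 1) := by
  rw [Finset.prod_one_add, Finset.sum_powerset]
  simp only [Finset.card_univ, Fintype.card_fin]
  rw [Finset.sum_range_succ']
  simp only [Finset.powersetCard_zero, Finset.sum_singleton, Finset.prod_empty]
  rw [add_comm, Finset.sum_range]
  congr 1
  refine Finset.sum_congr rfl fun k _ => ?_
  rw [Finset.sum_mul]
  refine Finset.sum_congr rfl fun t ht => ?_
  rw [Finset.prod_mul_distrib, Finset.prod_const, (Finset.mem_powersetCard.1 ht).2, mul_comm]

/-- An auxiliary form of `mulCoeff n`, in which the elementary symmetric functions of the `η`'s are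
replaced by variables. -/
noncomputable def mulAux (n : ℕ) : MvPolynomial (Fin n) (MvPolynomial (Fin n) ℤ) :=
  (∏ m : Fin n, (1 + ∑ k : Fin n,
    C (MvPolynomial.C (MvPolynomial.X k) * MvPolynomial.X m ^ (k.val + 1)) * X ^ (k.val + 1)) :
      (MvPolynomial (Fin n) (MvPolynomial (Fin n) ℤ))[X]).coeff n

lemma exists_mulAux (n : ℕ) : ∃ P : MvPolynomial (Fin n) (MvPolynomial (Fin n) ℤ),
    MvPolynomial.aeval (fun k : Fin n =>
      MvPolynomial.esymm (Fin n) (MvPolynomial (Fin n) ℤ) (k.val + 1)) P = mulAux n := by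
  have hsym : mulAux n ∈ MvPolynomial.symmetricSubalgebra (Fin n) (MvPolynomial (Fin n) ℤ) := by
    rw [MvPolynomial.mem_symmetricSubalgebra]
    intro σ
    change (MvPolynomial.rename σ : _ →ₐ[MvPolynomial (Fin n) ℤ] _).toRingHom (mulAux n) = _
    rw [mulAux, ← Polynomial.coeff_map, Polynomial.map_prod]
    congr 1
    refine Fintype.prod_equiv σ _ _ fun m => ?_
    simp [Polynomial.map_sum, MvPolynomial.rename_X]
  obtain ⟨P, hP⟩ := MvPolynomial.esymmAlgHom_fin_surjective _ (le_refl n) ⟨mulAux n, hsym⟩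
  exact ⟨P, by rw [← MvPolynomial.esymmAlgHom_apply, hP]⟩

lemma eval_mulAux {B : Type*} [CommRing B] (n : ℕ) (x y : Fin n → B)
    (ι : MvPolynomial (Fin n) ℤ →+* B)
    (hι : ∀ k : Fin n, ι (MvPolynomial.X k) =
      ∑ t ∈ Finset.powersetCard (k.val + 1) Finset.univ, ∏ i ∈ t, y i) :
    MvPolynomial.eval₂Hom ι x (mulAux n) =
      (∏ m : Fin n, ∏ k : Fin n, (1 + C (x m * y k) * X) : B[X]).coeff n := by
  rw [mulAux, ← Polynomial.coeff_map, Polynomial.map_prod]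
  congr 1
  refine Finset.prod_congr rfl fun m _ => ?_
  have h1 : (∏ k : Fin n, (1 + C (x m * y k) * X) : B[X]) =
      ∏ k : Fin n, (1 + (C (x m) * X) * C (y k)) :=
    Finset.prod_congr rfl fun k _ => by rw [C_mul]; ring
  rw [h1, exists_prod_one_add_mul n (C (x m) * X) (fun k => C (y k))]
  simp only [Polynomial.map_add, Polynomial.map_one, Polynomial.map_sum, Polynomial.map_mul,
    Polynomial.map_pow, Polynomial.map_X, Polynomial.map_C]
  congr 1
  refine Finset.sum_congr rfl fun k _ => ?_
  rw [map_mul, map_pow, MvPolynomial.coe_eval₂Hom, MvPolynomial.eval₂_C, MvPolynomial.eval₂_X, hι]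
  simp only [C_mul, C_pow, map_sum, map_prod]
  ring

/-- `mulCoeff n` is a polynomial in the elementary symmetric functions of the `ξ`'s and of the
`η`'s. -/
theorem exists_mulPoly (n : ℕ) : ∃ P : MvPolynomial (Fin n ⊕ Fin n) ℤ,
    MvPolynomial.aeval (Sum.elim
      (fun k : Fin n => MvPolynomial.rename (Sum.inl : Fin n → Fin n ⊕ Fin n)
        (MvPolynomial.esymm (Fin n) ℤ (k.val + 1)))
      (fun k : Fin n => MvPolynomial.rename (Sum.inr : Fin n → Fin n ⊕ Fin n)
        (MvPolynomial.esymm (Fin n) ℤ (k.val + 1)))) P = mulCoeff n := by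
  obtain ⟨P', hP'⟩ := exists_mulAux n
  obtain ⟨P, rfl⟩ := (MvPolynomial.sumAlgEquiv ℤ (Fin n) (Fin n)).surjective P'
  refine ⟨P, ?_⟩
  set y : Fin n → MvPolynomial (Fin n ⊕ Fin n) ℤ := fun k =>
    MvPolynomial.rename (Sum.inr : Fin n → Fin n ⊕ Fin n) (MvPolynomial.esymm (Fin n) ℤ (k.val + 1))
  set ι : MvPolynomial (Fin n) ℤ →+* MvPolynomial (Fin n ⊕ Fin n) ℤ :=
    (MvPolynomial.aeval y : _ →ₐ[ℤ] _).toRingHom with hιdef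
  have h := eval_mulAux n (fun m => MvPolynomial.X (Sum.inl m))
    (fun k => MvPolynomial.X (Sum.inr k)) ι (by
      intro k
      simp [hιdef, y, MvPolynomial.esymm])
  rw [mulCoeff, ← h, ← hP']
  clear h hP'
  induction P using MvPolynomial.induction_on with
  | C a => simp
  | add p q hp hq => rw [map_add, map_add, map_add, map_add, hp, hq]
  | mul_X p i hp =>
    rw [map_mul, map_mul, map_mul, map_mul, hp]
    congr 1
    cases i with
    | inl i => simp [MvPolynomial.esymm]
    | inr i => simp [hιdef, y]

/-- `compCoeff i j` is a polynomial in the elementary symmetric functions of the `ξ`'s. -/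
theorem exists_compPoly (i j : ℕ) : ∃ P : MvPolynomial (Fin (i * j)) ℤ,
    MvPolynomial.aeval (fun k : Fin (i * j) =>
      MvPolynomial.esymm (Fin (i * j)) ℤ (k.val + 1)) P = compCoeff i j := by
  have hsym : compCoeff i j ∈ MvPolynomial.symmetricSubalgebra (Fin (i * j)) ℤ := by
    rw [MvPolynomial.mem_symmetricSubalgebra]
    intro σ
    change (MvPolynomial.rename σ : _ →ₐ[ℤ] _).toRingHom (compCoeff i j) = _
    rw [compCoeff, ← Polynomial.coeff_map, Polynomial.map_prod]
    congr 1
    refine Finset.prod_bij (fun s _ => s.map σ.toEmbedding) ?_ ?_ ?_ ?_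
    · intro s hs
      simpa [Finset.mem_powersetCard] using hs
    · intro s _ t _ h
      exact Finset.map_injective _ h
    · intro t ht
      refine ⟨t.map σ.symm.toEmbedding, ?_, ?_⟩
      · simpa [Finset.mem_powersetCard] using ht
      · ext a
        simp
    · intro s _
      simp [Polynomial.map_prod]
  obtain ⟨P, hP⟩ := MvPolynomial.esymmAlgHom_fin_surjective ℤ (le_refl (i * j)) ⟨_, hsym⟩
  exact ⟨P, by rw [← MvPolynomial.esymmAlgHom_apply, hP]⟩

/-- The universal polynomial `P_n` in `2 n` variables: the (unique) polynomial with
`P_n(s_1, …, s_n; σ_1, …, σ_n) = mulCoeff n`, where the `s_k` and the `σ_k` are the elementary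
symmetric functions of the `ξ`'s and of the `η`'s. The variable `X (inl k)` stands for the argument
`s_{k+1}` and `X (inr k)` for the argument `σ_{k+1}`. -/
noncomputable def mulPoly (n : ℕ) : MvPolynomial (Fin n ⊕ Fin n) ℤ :=
  Classical.choose (exists_mulPoly n)

theorem mulPoly_spec (n : ℕ) :
    MvPolynomial.aeval (Sum.elim
      (fun k : Fin n => MvPolynomial.rename (Sum.inl : Fin n → Fin n ⊕ Fin n)
        (MvPolynomial.esymm (Fin n) ℤ (k.val + 1)))
      (fun k : Fin n => MvPolynomial.rename (Sum.inr : Fin n → Fin n ⊕ Fin n)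
        (MvPolynomial.esymm (Fin n) ℤ (k.val + 1)))) (mulPoly n) = mulCoeff n :=
  Classical.choose_spec (exists_mulPoly n)

/-- The universal polynomial `P_{i,j}` in `i j` variables: the (unique) polynomial with
`P_{i,j}(s_1, …, s_{ij}) = compCoeff i j`, where the `s_k` are the elementary symmetric functions of
the `ξ`'s. The variable `X k` stands for the argument `s_{k+1}`. -/
noncomputable def compPoly (i j : ℕ) : MvPolynomial (Fin (i * j)) ℤ :=
  Classical.choose (exists_compPoly i j)

theorem compPoly_spec (i j : ℕ) :
    MvPolynomial.aeval (fun k : Fin (i * j) =>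
      MvPolynomial.esymm (Fin (i * j)) ℤ (k.val + 1)) (compPoly i j) = compCoeff i j :=
  Classical.choose_spec (exists_compPoly i j)

/-! ### `λ`-rings, Adams operations and filtrations -/

/-- A `λ`-ring structure on the commutative ring `R` (a special `λ`-ring, in older terminology). -/
@[ext]
structure LambdaStructure (R : Type*) [CommRing R] where
  /-- The operations `λ^i`. -/
  lam : ℕ → R → R
  lam_zero : ∀ r, lam 0 r = 1
  lam_one : ∀ r, lam 1 r = r
  lam_apply_one : ∀ i, 1 < i → lam i 1 = 0
  lam_add : ∀ i r s, lam i (r + s) = ∑ k ∈ Finset.range (i + 1), lam k r * lam (i - k) s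
  lam_mul : ∀ i r s, lam i (r * s) =
    MvPolynomial.aeval (Sum.elim (fun k : Fin i => lam (k.val + 1) r)
      (fun k : Fin i => lam (k.val + 1) s)) (mulPoly i)
  lam_lam : ∀ i j r, lam i (lam j r) =
    MvPolynomial.aeval (fun k : Fin (i * j) => lam (k.val + 1) r) (compPoly i j)

/-- The sequence `ψ^n` obtained from a sequence `e_1, e_2, …` by the Newton formula
`ψ^n - e_1 ψ^{n-1} + ⋯ + (-1)^{n-1} e_{n-1} ψ^1 + (-1)^n n e_n = 0` for `n ≥ 1`. The value at
`n = 0` is not used. -/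
def newtonPsi {R : Type*} [CommRing R] (e : ℕ → R) : ℕ → R
  | 0 => 0
  | n + 1 => (-1) ^ n * ((n + 1 : ℕ) : R) * e (n + 1) +
      ∑ k : Fin n, (-1) ^ k.val * e (k.val + 1) * newtonPsi e (n - k.val)
termination_by n => n
decreasing_by omega

theorem newtonPsi_succ {R : Type*} [CommRing R] (e : ℕ → R) (n : ℕ) :
    newtonPsi e (n + 1) = (-1) ^ n * ((n + 1 : ℕ) : R) * e (n + 1) +
      ∑ k : Fin n, (-1) ^ k.val * e (k.val + 1) * newtonPsi e (n - k.val) := by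
  rw [newtonPsi]

lemma newtonPsi_powerSeries {R : Type*} [CommRing R] (e : ℕ → R) (h0 : e 0 = 1) :
    PowerSeries.mk (fun i => (-1) ^ i * e i) * PowerSeries.mk (fun i => newtonPsi e (i + 1)) =
      -PowerSeries.derivative R (PowerSeries.mk (fun i => (-1) ^ i * e i)) := by
  ext n
  rw [PowerSeries.coeff_mul, map_neg, PowerSeries.coeff_derivative,
    Finset.Nat.sum_antidiagonal_eq_sum_range_succ_mk, Finset.sum_range_succ', Finset.sum_range]
  simp only [PowerSeries.coeff_mk, pow_zero, h0, Nat.sub_zero, one_mul, newtonPsi_succ e n]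
  have : ∑ x : Fin n, (-1 : R) ^ (x.val + 1) * e (x.val + 1) * newtonPsi e (n - (x.val + 1) + 1) =
      -∑ k : Fin n, (-1) ^ k.val * e (k.val + 1) * newtonPsi e (n - k.val) := by
    rw [← Finset.sum_neg_distrib]
    refine Finset.sum_congr rfl fun k _ => ?_
    rw [show n - (k.val + 1) + 1 = n - k.val by omega]
    ring
  rw [this]
  push_cast
  ring

namespace LambdaStructure

variable {R : Type*} [CommRing R]

/-- The Adams operation `ψ^n`, for `n ≥ 1`. -/
def adams (L : LambdaStructure R) (n : ℕ) (r : R) : R := newtonPsi (fun i => L.lam i r) n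

theorem adams_add (L : LambdaStructure R) (n : ℕ) (r s : R) :
    L.adams n (r + s) = L.adams n r + L.adams n s := by
  cases n with
  | zero => simp [adams, newtonPsi]
  | succ n =>
    have key : ∀ t, PowerSeries.mk (fun i => (-1) ^ i * L.lam i t) *
        PowerSeries.mk (fun i => L.adams (i + 1) t) =
        -PowerSeries.derivative R (PowerSeries.mk (fun i => (-1) ^ i * L.lam i t)) :=
      fun t => newtonPsi_powerSeries (fun i => L.lam i t) (L.lam_zero t)
    have hmul : PowerSeries.mk (fun i => (-1) ^ i * L.lam i (r + s)) =
        PowerSeries.mk (fun i => (-1) ^ i * L.lam i r) *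
          PowerSeries.mk (fun i => (-1) ^ i * L.lam i s) := by
      ext i
      rw [PowerSeries.coeff_mul, Finset.Nat.sum_antidiagonal_eq_sum_range_succ_mk]
      simp only [PowerSeries.coeff_mk]
      rw [L.lam_add, Finset.mul_sum]
      refine Finset.sum_congr rfl fun k hk => ?_
      have hk' : k + (i - k) = i := by
        have := Finset.mem_range.1 hk
        omega
      rw [← hk', pow_add, show k + (i - k) - k = i - k by omega]
      ring
    have hunit : IsUnit (PowerSeries.mk (fun i => (-1) ^ i * L.lam i (r + s))) := by
      rw [PowerSeries.isUnit_iff_constantCoeff]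
      simp [← PowerSeries.coeff_zero_eq_constantCoeff_apply, L.lam_zero]
    have hfin : PowerSeries.mk (fun i => L.adams (i + 1) (r + s)) =
        PowerSeries.mk (fun i => L.adams (i + 1) r) +
          PowerSeries.mk (fun i => L.adams (i + 1) s) := by
      apply hunit.mul_left_cancel
      rw [key, hmul, Derivation.leibniz, smul_eq_mul, smul_eq_mul]
      linear_combination (-PowerSeries.mk (fun i => (-1) ^ i * L.lam i s)) * key r -
        (PowerSeries.mk (fun i => (-1) ^ i * L.lam i r)) * key s
    simpa using congrArg (PowerSeries.coeff n) hfin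

/-- The Adams operation `ψ^n` as a `ℤ`-linear endomorphism. -/
def psi (L : LambdaStructure R) (n : ℕ) : Module.End ℤ R :=
  (AddMonoidHom.mk' (L.adams n) (L.adams_add n)).toIntLinearMap

end LambdaStructure

/-- A decreasing sequence of ideals of `R`, which makes `R` a filtered ring. -/
structure RingFiltration (R : Type*) [CommRing R] where
  ideal : ℕ → Ideal R
  antitone : Antitone ideal

/-- A filtered `λ`-ring structure on the filtered ring `(R, F)`: the ideals of the filtration are
closed under the operations `λ^i` for `i > 0`. -/
@[ext]
structure FilteredLambdaStructure (R : Type*) [CommRing R] (F : RingFiltration R) extends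
    LambdaStructure R where
  lam_mem : ∀ n i, 0 < i → ∀ r ∈ F.ideal n, lam i r ∈ F.ideal n

/-! ### `λ`-ring cohomology in degree zero -/

/-- The algebra of `ℤ`-linear endomorphisms `f` of `R` with `f(r)^p ≡ f(r^p) (mod pR)` for all
primes `p` and all `r`. Its elements are the `0`-cochains. -/
def endBar (R : Type*) [CommRing R] : Subalgebra ℤ (Module.End ℤ R) where
  carrier := {f | ∀ p : ℕ, p.Prime → ∀ r : R, (p : R) ∣ f r ^ p - f (r ^ p)}
  mul_mem' := by
    intro f g hf hg p hp r
    obtain ⟨c, hc⟩ := hg p hp r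
    have h1 := hf p hp (g r)
    have h2 : f (g r ^ p) - f (g (r ^ p)) = (p : R) * f c := by
      rw [← map_sub, hc, ← nsmul_eq_mul, map_nsmul, nsmul_eq_mul]
    have h3 := dvd_add h1 (Dvd.intro _ h2.symm)
    simpa using h3
  add_mem' := by
    intro f g hf hg p hp r
    obtain ⟨c, hc⟩ := exists_add_pow_prime_eq hp (f r) (g r)
    have h := dvd_add (dvd_add (hf p hp r) (hg p hp r))
      (Dvd.intro (f r * g r * c) rfl : (p : R) ∣ (p : R) * (f r * g r * c))
    simp only [LinearMap.add_apply]
    rw [hc]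
    convert h using 1
    ring
  algebraMap_mem' := by
    intro n p hp r
    have h : (p : ℤ) ∣ n ^ p - n := by
      have := Fact.mk hp
      rw [← ZMod.intCast_zmod_eq_zero_iff_dvd]
      push_cast
      rw [ZMod.pow_card, sub_self]
    obtain ⟨c, hc⟩ := h
    have hc' : (n : R) ^ p - n = p * c := by exact_mod_cast congrArg (Int.cast : ℤ → R) hc
    refine ⟨c * r ^ p, ?_⟩
    simp only [Module.algebraMap_end_apply, zsmul_eq_mul]
    rw [mul_pow, ← mul_assoc, ← hc']
    ring

/-- The differential `d^0` of the cochain complex, `(d^0 f)(m) = ψ^m f - f ψ^m` for positive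
integers `m`. A `1`-cochain is a function from the positive integers to `End(R)` subject to a
condition at the primes, which plays no role for the kernel of `d^0`. -/
def coboundaryZero {R : Type*} [CommRing R] (L : LambdaStructure R) :
    Module.End ℤ R →ₗ[ℤ] (ℕ+ → Module.End ℤ R) where
  toFun f m := L.psi m * f - f * L.psi m
  map_add' f g := by
    funext m
    simp only [Pi.add_apply, mul_add, add_mul]
    abel
  map_smul' c f := by
    funext m
    simp only [Pi.smul_apply, mul_smul_comm, smul_mul_assoc, smul_sub, RingHom.id_apply]

/-- The algebra `H_λ^0(R)`: the `0`-cochains with zero coboundary, with composition as product. -/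
def lambdaCohomologyZero {R : Type*} [CommRing R] (L : LambdaStructure R) :
    Subalgebra ℤ (Module.End ℤ R) where
  carrier := {f | f ∈ endBar R ∧ coboundaryZero L f = 0}
  mul_mem' := by
    rintro f g ⟨hf, hf'⟩ ⟨hg, hg'⟩
    refine ⟨mul_mem hf hg, ?_⟩
    funext m
    have h1 : L.psi m * f = f * L.psi m := sub_eq_zero.1 (congrFun hf' m)
    have h2 : L.psi m * g = g * L.psi m := sub_eq_zero.1 (congrFun hg' m)
    change L.psi m * (f * g) - f * g * L.psi m = 0
    rw [← mul_assoc, h1, mul_assoc, h2, mul_assoc, sub_self]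
  add_mem' := by
    rintro f g ⟨hf, hf'⟩ ⟨hg, hg'⟩
    exact ⟨add_mem hf hg, by rw [map_add, hf', hg', add_zero]⟩
  algebraMap_mem' := by
    intro n
    refine ⟨(endBar R).algebraMap_mem n, ?_⟩
    funext m
    change L.psi m * algebraMap ℤ _ n - algebraMap ℤ _ n * L.psi m = 0
    rw [Algebra.commutes, sub_self]

/-! ### The truncated polynomial ring `ℤ[x]/(x^4)` -/

/-- The ring `ℤ[x]/(x^4)`. -/
abbrev TruncRing : Type := AdjoinRoot (X ^ 4 : ℤ[X])

/-- The class of `x`. -/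
noncomputable def truncX : TruncRing := AdjoinRoot.root (X ^ 4 : ℤ[X])

/-- The standard basis `1, x, x^2, x^3`. -/
noncomputable def truncBasis : Module.Basis (Fin 4) ℤ TruncRing :=
  (AdjoinRoot.powerBasis' (monic_X_pow 4 : (X ^ 4 : ℤ[X]).Monic)).basis.reindex
    (finCongr (natDegree_X_pow 4))

theorem truncBasis_apply (i : Fin 4) : truncBasis i = truncX ^ i.val := by
  rw [truncBasis, Module.Basis.reindex_apply, PowerBasis.basis_eq_pow]
  rfl

/-- The filtration of `ℤ[x]/(x^4)` for which `x` has filtration `e`: the `n`-th ideal is generated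
by the powers `x^k` with `e * k ≥ n`. -/
noncomputable def truncFiltration (e : ℕ) : RingFiltration TruncRing where
  ideal n := Ideal.span {y | ∃ k : ℕ, n ≤ e * k ∧ y = truncX ^ k}
  antitone := by
    intro m n hmn
    refine Ideal.span_mono ?_
    rintro y ⟨k, hk, rfl⟩
    exact ⟨k, hmn.trans hk, rfl⟩

/-- The coefficient `d_p` of `x^3` in `ψ^p(x)`, for `p` prime, in terms of `h` and `d_2`. -/
def dCoeff (h d2 : ℤ) (p : ℕ) : ℚ :=
  if p = 2 then d2 else
    (p : ℚ) ^ 2 * ((p : ℚ) ^ 4 - 1) / 60 * d2 +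
      (p : ℚ) ^ 2 * ((p : ℚ) ^ 2 - 1) * ((p : ℚ) ^ 2 - 4) / 360 * (h : ℚ) ^ 2

/-- The `λ`-ring structure `L` on `ℤ[x]/(x^4)` has the Adams operations of `S(h, d_2)`:
`ψ^p(x) = p^2 x + h (p^2 (p^2 - 1) / 12) x^2 + d_p x^3` for all primes `p`. -/
def IsS (h d2 : ℤ) (L : LambdaStructure TruncRing) : Prop :=
  ∀ p : ℕ, p.Prime → ∃ c d : ℤ,
    (c : ℚ) = h * ((p : ℚ) ^ 2 * ((p : ℚ) ^ 2 - 1) / 12) ∧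
    (d : ℚ) = dCoeff h d2 p ∧
    L.adams p truncX = (p : TruncRing) ^ 2 * truncX + (c : TruncRing) * truncX ^ 2 +
      (d : TruncRing) * truncX ^ 3

/-! Existence and uniqueness rest on the fact that in a torsion-free ring the Newton formula turns
`λ`-operations into Adams operations and back. If the `ψ^n` are ring endomorphisms with `ψ^m ψ^n =
ψ^{mn}` and the Newton formula can be solved for the `λ^i`, then all `λ`-ring axioms follow by
comparing Newton sums after splitting `∑ λ^i t^i` into linear factors in an extension ring
(`LambdaStructure.exists_of_adams`). The solvable elements form a subring (`newtonSubring`), so only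
`x` matters. There, with `v = t/(1-t)^2`, the series `λ_{-t}(x)` has the closed form `1 - v x + a
v^2 x^2 + (c v^2 - b v^3) x^3`. Its coefficients `a, b, c` are integers because `h` is odd and prime
to 3 and `d_2` is even (`exists_newtonPsi_eq_adamsPoly`). Conversely, the values `ψ^p(x)` at primes
determine every `ψ^n` (`isS_iff`), hence every `λ^i`.

For the cohomology, `ψ^2` is lower triangular with distinct diagonal entries 1, 4, 16, 64. Commuting
with it forces the displayed matrix shape and three linear equations
(`mem_commutantSet_of_commute`), and these already imply commutation with every `ψ^n`
(`adamsMatrix_mul_comm`). The congruences `f(r)^p ≡ f(r^p)` only matter for `p = 2, 3`, since `x^p =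
0` otherwise, and there they follow from the three equations (`mem_lambdaCohomologyZero_iff`). The
entries `a, j, k, l` determine the matrix, which gives an embedding into `ℤ^4` with image of full
rank. -/

/-! ### The Newton formula -/

section Newton

variable {R S : Type*} [CommRing R] [CommRing S]

theorem newtonPsi_congr {e f : ℕ → R} {n : ℕ} (h : ∀ k, 0 < k → k ≤ n → e k = f k) :
    newtonPsi e n = newtonPsi f n := by
  induction n using Nat.strong_induction_on with
  | _ n ih =>
    cases n with
    | zero => simp [newtonPsi]
    | succ n =>
      rw [newtonPsi_succ, newtonPsi_succ, h (n + 1) (by omega) le_rfl]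
      congr 1
      refine Finset.sum_congr rfl fun k _ => ?_
      rw [h (k.val + 1) (by omega) (by omega),
        ih (n - k.val) (by omega) fun m hm hm' => h m hm (by omega)]

theorem newtonPsi_one (e : ℕ → R) : newtonPsi e 1 = e 1 := by
  rw [newtonPsi_succ]
  simp

theorem map_newtonPsi (φ : R →+* S) (e : ℕ → R) (n : ℕ) :
    φ (newtonPsi e n) = newtonPsi (fun i => φ (e i)) n := by
  induction n using Nat.strong_induction_on with
  | _ n ih =>
    cases n with
    | zero => simp [newtonPsi]
    | succ n =>
      rw [newtonPsi_succ, newtonPsi_succ, map_add, map_sum]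
      congr 1
      · simp
      · refine Finset.sum_congr rfl fun k _ => ?_
        rw [map_mul, ih (n - k.val) (by omega)]
        simp

/-- In a torsion-free ring the Newton formula can be solved for the `e_k`. -/
theorem eq_of_newtonPsi_eq [IsAddTorsionFree R] {e f : ℕ → R} {n : ℕ} (h0 : e 0 = f 0)
    (h : ∀ k, 0 < k → k ≤ n → newtonPsi e k = newtonPsi f k) : e n = f n := by
  induction n using Nat.strong_induction_on with
  | _ n ih =>
    cases n with
    | zero => exact h0
    | succ n =>
      have hlt : ∀ k, k ≤ n → e k = f k := fun k hk =>
        ih k (by omega) fun m hm hm' => h m hm (by omega)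
      have hn := h (n + 1) (by omega) le_rfl
      rw [newtonPsi_succ, newtonPsi_succ] at hn
      have hs : ∑ k : Fin n, (-1) ^ k.val * e (k.val + 1) * newtonPsi e (n - k.val) =
          ∑ k : Fin n, (-1) ^ k.val * f (k.val + 1) * newtonPsi f (n - k.val) :=
        Finset.sum_congr rfl fun k _ => by
          rw [hlt (k.val + 1) (by omega), h (n - k.val) (by omega) (by omega)]
      rw [hs, add_left_inj, mul_assoc, mul_assoc] at hn
      -- Multiplying by `(-1)^n` removes the sign; the factor `n + 1` is then cancelled by
      -- torsion-freeness.
      have hn' := congrArg (fun z => (-1 : R) ^ n * z) hn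
      simp only [← mul_assoc, ← mul_pow, mul_neg, neg_mul, neg_neg, one_pow, one_mul] at hn'
      exact nsmul_right_injective (Nat.succ_ne_zero n) (by simpa [nsmul_eq_mul] using hn')

/-- The Newton sums are the coefficients of minus the logarithmic derivative of `∑ (-1)^i e_i t^i`,
and logarithmic derivatives turn products into sums. -/
theorem newtonPsi_mul {e f g : ℕ → R} (he : e 0 = 1) (hf : f 0 = 1)
    (hg : ∀ i, g i = ∑ k ∈ Finset.range (i + 1), e k * f (i - k)) (n : ℕ) :
    newtonPsi g n = newtonPsi e n + newtonPsi f n := by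
  cases n with
  | zero => simp [newtonPsi]
  | succ n =>
    have hg0 : g 0 = 1 := by simp [hg, he, hf]
    have hmul : PowerSeries.mk (fun i => (-1) ^ i * g i) =
        PowerSeries.mk (fun i => (-1) ^ i * e i) * PowerSeries.mk (fun i => (-1) ^ i * f i) := by
      ext i
      rw [PowerSeries.coeff_mul, Finset.Nat.sum_antidiagonal_eq_sum_range_succ_mk]
      simp only [PowerSeries.coeff_mk]
      rw [hg, Finset.mul_sum]
      refine Finset.sum_congr rfl fun k hk => ?_
      obtain ⟨l, rfl⟩ : ∃ l, i = k + l := ⟨i - k, by have := Finset.mem_range.1 hk; omega⟩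
      rw [pow_add, show k + l - k = l by omega]
      ring
    have hunit : IsUnit (PowerSeries.mk (fun i => (-1) ^ i * g i)) := by
      rw [PowerSeries.isUnit_iff_constantCoeff]
      simp [← PowerSeries.coeff_zero_eq_constantCoeff_apply, hg0]
    have hfin : PowerSeries.mk (fun i => newtonPsi g (i + 1)) =
        PowerSeries.mk (fun i => newtonPsi e (i + 1)) +
          PowerSeries.mk (fun i => newtonPsi f (i + 1)) := by
      apply hunit.mul_left_cancel
      rw [newtonPsi_powerSeries g hg0, hmul, Derivation.leibniz, smul_eq_mul, smul_eq_mul]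
      linear_combination (-PowerSeries.mk (fun i => (-1) ^ i * f i)) * newtonPsi_powerSeries e he -
        (PowerSeries.mk (fun i => (-1) ^ i * e i)) * newtonPsi_powerSeries f hf
    simpa using congrArg (PowerSeries.coeff n) hfin

/-- The power series determined by the Newton formula. -/
theorem newtonPsi_eq_of_powerSeries {e p : ℕ → R} (h0 : e 0 = 1)
    (h : PowerSeries.mk (fun i => (-1) ^ i * e i) * PowerSeries.mk (fun i => p (i + 1)) =
      -PowerSeries.derivative R (PowerSeries.mk (fun i => (-1) ^ i * e i))) {n : ℕ} (hn : 0 < n) :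
    newtonPsi e n = p n := by
  have hunit : IsUnit (PowerSeries.mk (fun i => (-1) ^ i * e i)) := by
    rw [PowerSeries.isUnit_iff_constantCoeff]
    simp [← PowerSeries.coeff_zero_eq_constantCoeff_apply, h0]
  have := hunit.mul_left_cancel ((newtonPsi_powerSeries e h0).trans h.symm)
  obtain ⟨n, rfl⟩ := Nat.exists_eq_succ_of_ne_zero hn.ne'
  simpa using congrArg (PowerSeries.coeff n) this

theorem newtonPsi_linear (y : R) {n : ℕ} (hn : 0 < n) :
    newtonPsi (1 + C y * X : R[X]).coeff n = y ^ n := by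
  induction n, hn using Nat.le_induction with
  | base => simp [newtonPsi_one, coeff_one]
  | succ n hn ih =>
    rw [newtonPsi_succ]
    obtain ⟨m, rfl⟩ := Nat.exists_eq_succ_of_ne_zero (Nat.pos_iff_ne_zero.1 hn)
    rw [Fin.sum_univ_succ, Finset.sum_eq_zero]
    · simp only [Fin.val_zero, Nat.sub_zero, ih]
      simp [coeff_one, pow_succ']
    · intro k _
      simp [coeff_one]

theorem coeff_zero_prod_one_add {ι : Type*} (s : Finset ι) (y : ι → R) :
    (∏ i ∈ s, (1 + C (y i) * X) : R[X]).coeff 0 = 1 := by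
  simp [coeff_zero_eq_eval_zero, eval_prod]

/-- Newton's identities between elementary symmetric functions and power sums, obtained by adding
one linear factor at a time. -/
theorem newtonPsi_prod {ι : Type*} (s : Finset ι) (y : ι → R) {n : ℕ} (hn : 0 < n) :
    newtonPsi (∏ i ∈ s, (1 + C (y i) * X) : R[X]).coeff n = ∑ i ∈ s, y i ^ n := by
  classical
  induction s using Finset.induction_on with
  | empty =>
    -- The empty product is treated as a linear factor with root 0.
    have := newtonPsi_linear (0 : R) hn
    simpa [hn.ne'] using this
  | insert a s ha ih =>
    rw [Finset.sum_insert ha, ← ih, ← newtonPsi_linear (y a) hn]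
    refine newtonPsi_mul (by simp) (coeff_zero_prod_one_add s y) (fun i => ?_) n
    rw [Finset.prod_insert ha, coeff_mul, Finset.Nat.sum_antidiagonal_eq_sum_range_succ_mk]

theorem coeff_prod_one_add {ι : Type*} (s : Finset ι) (y : ι → R) (n : ℕ) :
    (∏ i ∈ s, (1 + C (y i) * X) : R[X]).coeff n =
      ∑ t ∈ s.powersetCard n, ∏ i ∈ t, y i := by
  classical
  rw [Finset.prod_one_add, finsetSum_coeff]
  have h : ∀ t ∈ s.powerset, (∏ i ∈ t, (C (y i) * X) : R[X]).coeff n =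
      if t.card = n then ∏ i ∈ t, y i else 0 := by
    intro t _
    rw [Finset.prod_mul_distrib, Finset.prod_const, ← map_prod, coeff_C_mul_X_pow]
    simp [eq_comm]
  rw [Finset.sum_congr rfl h, ← Finset.sum_filter]
  congr 1
  ext t
  simp [Finset.mem_powersetCard]

end Newton

/-! ### Splitting a sequence into linear factors -/

theorem isAddTorsionFree_of_free (R S : Type*) [CommRing R] [CommRing S] [Algebra R S]
    [Module.Free R S] [IsAddTorsionFree R] : IsAddTorsionFree S :=
  Function.Injective.isAddTorsionFree (Module.Free.chooseBasis R S).repr.toLinearMap.toAddMonoidHom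
    (Module.Free.chooseBasis R S).repr.injective

/-- The splitting principle: a monic polynomial splits over a free extension. Freeness keeps the
extension torsion-free, so Newton sums still determine sequences there, and injectivity brings
identities back to `R`. -/
theorem exists_coeff_prod_one_add.{u} {R : Type u} [CommRing R] [Nontrivial R] [IsAddTorsionFree R]
    (e : ℕ → R) (he : e 0 = 1) (N : ℕ) :
    ∃ (S : Type u) (_ : CommRing S) (_ : Nontrivial S) (_ : IsAddTorsionFree S) (φ : R →+* S)
      (ξ : Fin N → S), Function.Injective φ ∧
        ∀ k ≤ N, φ (e k) = (∏ m, (1 + C (ξ m) * X) : S[X]).coeff k := by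
  -- The order of coefficients is reversed because the coefficient of `X^{N-k}` in `∏ (X + ξ_m)` is
  -- the `k`-th elementary symmetric function.
  set p : R[X] := X ^ N + ∑ k ∈ Finset.range N, C (e (N - k)) * X ^ k with hp
  have hlt : (∑ k ∈ Finset.range N, C (e (N - k)) * X ^ k : R[X]).degree < (N : ℕ) :=
    (degree_sum_le _ _).trans_lt ((Finset.sup_lt_iff (WithBot.bot_lt_coe N)).2 fun k hk =>
      (degree_C_mul_X_pow_le _ _).trans_lt (WithBot.coe_lt_coe.2 (Finset.mem_range.1 hk)))
  have hmon : p.Monic := monic_X_pow_add hlt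
  have hdeg : p.natDegree = N := by
    apply natDegree_eq_of_degree_eq_some
    rw [hp, degree_add_eq_left_of_degree_lt (by rwa [degree_X_pow]), degree_X_pow]
  have hcoeff : ∀ k ≤ N, p.coeff (N - k) = e k := by
    intro k hk
    simp only [hp, coeff_add, coeff_X_pow, finsetSum_coeff, coeff_C_mul, mul_ite, mul_one,
      mul_zero]
    rcases Nat.eq_zero_or_pos k with rfl | hk0
    · rw [Finset.sum_eq_zero]
      · simp [he]
      · intro i hi
        rw [if_neg]
        have := Finset.mem_range.1 hi
        omega
    · rw [Finset.sum_eq_single (N - k)]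
      · rw [if_neg (by omega), if_pos rfl, zero_add, Nat.sub_sub_self hk]
      · intro b _ hb
        rw [if_neg (Ne.symm hb)]
      · intro h
        exact absurd (Finset.mem_range.2 (by omega)) h
  obtain ⟨S, _, _, _, _, _, hS⟩ := hmon.exists_splits_map
  obtain ⟨m, hm⟩ := splits_iff_exists_multiset'.1 hS
  rw [(hmon.map _).leadingCoeff, C_1, one_mul] at hm
  have hcard : Multiset.card m = N := by
    have h1 := congrArg natDegree hm
    rw [hmon.natDegree_map, hdeg, natDegree_multiset_prod_of_monic] at h1
    · simpa using h1.symm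
    · intro f hf
      obtain ⟨a, -, rfl⟩ := Multiset.mem_map.1 hf
      exact monic_X_add_C a
  subst hcard
  obtain ⟨l, rfl⟩ : ∃ l : List S, (l : Multiset S) = m := Quot.exists_rep m
  refine ⟨S, inferInstance, inferInstance, isAddTorsionFree_of_free R S, algebraMap R S,
    fun i => l.get i, ?_, ?_⟩
  · exact FaithfulSMul.algebraMap_injective R S
  · intro k hk
    rw [← hcoeff k hk, ← coeff_map, hm, Multiset.prod_X_add_C_coeff _ (Nat.sub_le _ _),
      Nat.sub_sub_self hk, coeff_prod_one_add, ← Finset.esymm_map_val]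
    congr 1
    simp only [Fin.univ_val_map]
    exact congrArg _ (List.ofFn_get l).symm

/-! ### The universal polynomials and the Newton formula -/

section Universal

variable {R S : Type*} [CommRing R] [CommRing S]

theorem map_aeval_int [Algebra ℤ R] [Algebra ℤ S] (φ : R →+* S) {σ : Type*} (f : σ → R)
    (P : MvPolynomial σ ℤ) :
    φ (MvPolynomial.aeval f P) = MvPolynomial.aeval (fun i => φ (f i)) P :=
  MvPolynomial.comp_aeval_apply f { φ with commutes' := fun n => by simp : R →ₐ[ℤ] S } P

/-- The defining identity of `mulPoly` holds for indeterminates, so it may be specialised to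
elements of any commutative ring. -/
theorem aeval_mulPoly {n : ℕ} (ξ η : Fin n → R) :
    MvPolynomial.aeval (Sum.elim
      (fun k : Fin n => (∏ m, (1 + C (ξ m) * X) : R[X]).coeff (k.val + 1))
      (fun k : Fin n => (∏ m, (1 + C (η m) * X) : R[X]).coeff (k.val + 1))) (mulPoly n) =
    (∏ m : Fin n × Fin n, (1 + C (ξ m.1 * η m.2) * X) : R[X]).coeff n := by
  have h := congrArg (MvPolynomial.aeval (R := ℤ) (Sum.elim ξ η)).toRingHom (mulPoly_spec n)
  rw [map_aeval_int, mulCoeff, ← Polynomial.coeff_map,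
    Polynomial.map_prod] at h
  convert h using 2
  · congr 1
    ext k
    cases k <;> simp [coeff_prod_one_add, MvPolynomial.esymm]
  · rw [Fintype.prod_prod_type]
    refine Finset.prod_congr rfl fun m _ => ?_
    rw [Polynomial.map_prod]
    simp

theorem aeval_compPoly {i j : ℕ} (ξ : Fin (i * j) → R) :
    MvPolynomial.aeval (fun k : Fin (i * j) => (∏ m, (1 + C (ξ m) * X) : R[X]).coeff (k.val + 1))
      (compPoly i j) =
    (∏ s ∈ (Finset.univ : Finset (Fin (i * j))).powersetCard j,
      (1 + C (∏ l ∈ s, ξ l) * X) : R[X]).coeff i := by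
  have h := congrArg (MvPolynomial.aeval (R := ℤ) ξ).toRingHom (compPoly_spec i j)
  rw [map_aeval_int, compCoeff, ← Polynomial.coeff_map,
    Polynomial.map_prod] at h
  convert h using 2
  · congr 1
    ext k
    simp [coeff_prod_one_add, MvPolynomial.esymm]
  · simp [Polynomial.map_prod]

theorem newtonPsi_of_coeff {N : ℕ} {e : ℕ → R} {ξ : Fin N → R}
    (h : ∀ k ≤ N, e k = (∏ m, (1 + C (ξ m) * X) : R[X]).coeff k) {n : ℕ} (hn : 0 < n)
    (hnN : n ≤ N) : newtonPsi e n = ∑ m, ξ m ^ n := by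
  rw [← newtonPsi_prod Finset.univ ξ hn]
  exact newtonPsi_congr fun k _ hk => h k (hk.trans hnN)

end Universal

section

universe u

variable {R : Type u} [CommRing R] [Nontrivial R] [IsAddTorsionFree R]

theorem exists_coeff_prod_one_add₂ (e f : ℕ → R) (he : e 0 = 1) (hf : f 0 = 1) (N : ℕ) :
    ∃ (S : Type u) (_ : CommRing S) (_ : Nontrivial S) (_ : IsAddTorsionFree S) (φ : R →+* S)
      (ξ η : Fin N → S), Function.Injective φ ∧
        (∀ k ≤ N, φ (e k) = (∏ m, (1 + C (ξ m) * X) : S[X]).coeff k) ∧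
        ∀ k ≤ N, φ (f k) = (∏ m, (1 + C (η m) * X) : S[X]).coeff k := by
  obtain ⟨S, _, _, _, φ, ξ, hφ, hξ⟩ := exists_coeff_prod_one_add e he N
  obtain ⟨T, _, _, _, χ, η, hχ, hη⟩ :=
    exists_coeff_prod_one_add (fun k => φ (f k)) (by simp [hf]) N
  refine ⟨T, inferInstance, inferInstance, inferInstance, χ.comp φ, fun m => χ (ξ m), η,
    hχ.comp hφ, fun k hk => ?_, hη⟩
  rw [RingHom.comp_apply, hξ k hk, ← coeff_map, Polynomial.map_prod]
  simp

/-- The sequence with Newton sums `newtonPsi e n * newtonPsi f n` is given by `mulPoly`. -/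
theorem eq_aeval_mulPoly {e f g : ℕ → R} (he : e 0 = 1) (hf : f 0 = 1) (hg : g 0 = 1) (i : ℕ)
    (h : ∀ n, 0 < n → n ≤ i → newtonPsi g n = newtonPsi e n * newtonPsi f n) :
    g i = MvPolynomial.aeval (Sum.elim (fun k : Fin i => e (k.val + 1))
      (fun k : Fin i => f (k.val + 1))) (mulPoly i) := by
  obtain ⟨S, _, _, _, φ, ξ, η, hφ, hξ, hη⟩ := exists_coeff_prod_one_add₂ e f he hf i
  apply hφ
  rw [map_aeval_int]
  have h1 : (fun k : Fin i ⊕ Fin i => φ (Sum.elim (fun k : Fin i => e (k.val + 1))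
      (fun k : Fin i => f (k.val + 1)) k)) = Sum.elim
      (fun k : Fin i => (∏ m, (1 + C (ξ m) * X) : S[X]).coeff (k.val + 1))
      (fun k : Fin i => (∏ m, (1 + C (η m) * X) : S[X]).coeff (k.val + 1)) := by
    ext k
    cases k with
    | inl k => exact hξ _ k.isLt
    | inr k => exact hη _ k.isLt
  rw [h1, aeval_mulPoly]
  refine eq_of_newtonPsi_eq (e := fun k => φ (g k)) ?_ fun n hn hni => ?_
  · rw [hg, map_one, coeff_zero_prod_one_add]
  · rw [← map_newtonPsi, h n hn hni, newtonPsi_prod _ _ hn, map_mul, map_newtonPsi, map_newtonPsi,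
      newtonPsi_of_coeff hξ hn hni, newtonPsi_of_coeff hη hn hni, Fintype.sum_mul_sum,
      Fintype.sum_prod_type]
    simp only [mul_pow]

/-- After splitting, the sequence has roots `ξ_a η_b`, whose power sums factor. This serves both to
make `ψ^n` multiplicative in a `λ`-ring and to close `newtonSubring` under products. -/
theorem newtonPsi_mulPoly {e f : ℕ → R} (he : e 0 = 1) (hf : f 0 = 1) {n : ℕ} (hn : 0 < n) :
    newtonPsi (fun i => MvPolynomial.aeval (Sum.elim (fun k : Fin i => e (k.val + 1))
      (fun k : Fin i => f (k.val + 1))) (mulPoly i)) n = newtonPsi e n * newtonPsi f n := by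
  obtain ⟨S, _, _, _, φ, ξ, η, hφ, hξ, hη⟩ := exists_coeff_prod_one_add₂ e f he hf n
  apply hφ
  have hsum : ∀ m, 0 < m → m ≤ n →
      newtonPsi (∏ a : Fin n × Fin n, (1 + C (ξ a.1 * η a.2) * X) : S[X]).coeff m =
        newtonPsi (fun k => φ (e k)) m * newtonPsi (fun k => φ (f k)) m := by
    intro m hm hmn
    rw [newtonPsi_prod _ _ hm, newtonPsi_of_coeff hξ hm hmn, newtonPsi_of_coeff hη hm hmn,
      Fintype.sum_mul_sum, Fintype.sum_prod_type]
    simp only [mul_pow]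
  rw [map_newtonPsi, map_mul, map_newtonPsi, map_newtonPsi, ← hsum n hn le_rfl]
  refine newtonPsi_congr fun i _ hi => ?_
  rw [eq_aeval_mulPoly (e := fun k => φ (e k)) (f := fun k => φ (f k)) (by simp [he])
    (by simp [hf]) (coeff_zero_prod_one_add _ _) i fun m hm hmi => hsum m hm (hmi.trans hi),
    map_aeval_int]
  congr 2
  ext k
  cases k <;> rfl

/-- If the sequences `g n` have the Newton sums `newtonPsi e (n m)`, then the sequence with Newton
sums `g n j` is given by `compPoly`. -/
theorem eq_aeval_compPoly {e E : ℕ → R} {g : ℕ → ℕ → R} (he : e 0 = 1) (hE : E 0 = 1)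
    (hg : ∀ n, g n 0 = 1) (i j : ℕ)
    (hgm : ∀ n m, 0 < n → n ≤ i → 0 < m → m ≤ j → newtonPsi (g n) m = newtonPsi e (n * m))
    (h : ∀ n, 0 < n → n ≤ i → newtonPsi E n = g n j) :
    E i = MvPolynomial.aeval (fun k : Fin (i * j) => e (k.val + 1)) (compPoly i j) := by
  obtain ⟨S, _, _, _, φ, ξ, hφ, hξ⟩ := exists_coeff_prod_one_add e he (i * j)
  apply hφ
  rw [map_aeval_int]
  have h1 : (fun k : Fin (i * j) => φ (e (k.val + 1))) =
      fun k : Fin (i * j) => (∏ m, (1 + C (ξ m) * X) : S[X]).coeff (k.val + 1) := by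
    ext k
    exact hξ _ k.isLt
  rw [h1, aeval_compPoly]
  refine eq_of_newtonPsi_eq (e := fun k => φ (E k)) ?_ fun n hn hni => ?_
  · rw [hE, map_one, coeff_zero_prod_one_add]
  · rw [← map_newtonPsi, h n hn hni, newtonPsi_prod _ _ hn]
    -- The sequence `g n` has roots `ξ_l^n`, and the `j`-th elementary symmetric function of these
    -- is the `n`-th power sum of the `j`-fold products of the `ξ_l`.
    have h2 : φ (g n j) = (∏ l, (1 + C (ξ l ^ n) * X) : S[X]).coeff j := by
      refine eq_of_newtonPsi_eq (e := fun k => φ (g n k)) ?_ fun m hm hmj => ?_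
      · rw [hg, map_one, coeff_zero_prod_one_add]
      · rw [← map_newtonPsi, hgm n m hn hni hm hmj, newtonPsi_prod _ _ hm, map_newtonPsi,
          newtonPsi_of_coeff hξ (Nat.mul_pos hn hm) (Nat.mul_le_mul hni hmj)]
        simp only [pow_mul]
    rw [h2, coeff_prod_one_add]
    simp only [Finset.prod_pow]

theorem newtonPsi_compPoly {N : ℕ} {e : ℕ → R} {ξ : Fin N → R}
    (h : ∀ k ≤ N, e k = (∏ m, (1 + C (ξ m) * X) : R[X]).coeff k) {n j : ℕ} (hn : 0 < n)
    (hnj : n * j ≤ N) :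
    newtonPsi (fun i => MvPolynomial.aeval (fun k : Fin (i * j) => e (k.val + 1))
      (compPoly i j)) n = (∏ l, (1 + C (ξ l ^ n) * X) : R[X]).coeff j := by
  have hsum : ∀ a, 0 < a →
      newtonPsi (∏ s ∈ (Finset.univ : Finset (Fin N)).powersetCard j,
        (1 + C (∏ l ∈ s, ξ l) * X) : R[X]).coeff a =
      (∏ l, (1 + C (ξ l ^ a) * X) : R[X]).coeff j := by
    intro a ha
    rw [newtonPsi_prod _ _ ha, coeff_prod_one_add]
    simp only [Finset.prod_pow]
  rw [← hsum n hn]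
  refine newtonPsi_congr fun i _ hi => ?_
  refine (eq_aeval_compPoly (g := fun a => (∏ l, (1 + C (ξ l ^ a) * X) : R[X]).coeff)
    (by rw [h 0 (Nat.zero_le _), coeff_zero_prod_one_add]) (coeff_zero_prod_one_add _ _)
    (fun a => coeff_zero_prod_one_add _ _) i j (fun a m ha hai hm hmj => ?_)
    fun a ha _ => hsum a ha).symm
  rw [newtonPsi_prod _ _ hm, newtonPsi_of_coeff h (Nat.mul_pos ha hm)
    ((Nat.mul_le_mul (hai.trans hi) hmj).trans hnj)]
  simp only [pow_mul]

end

/-! ### `λ`-rings and Adams operations -/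

section Adams

universe u

variable {R : Type u} [CommRing R]

theorem newtonPsi_unit {n : ℕ} (hn : 0 < n) :
    newtonPsi (fun i => if i ≤ 1 then (1 : R) else 0) n = 1 := by
  refine Eq.trans ?_ ((newtonPsi_linear (1 : R) hn).trans (one_pow n))
  refine newtonPsi_congr fun k hk _ => ?_
  rcases Nat.lt_or_ge 1 k with h1 | h1
  · simp [coeff_one, coeff_X, hk.ne', h1.ne, h1.not_ge]
  · obtain rfl : k = 1 := by omega
    simp [coeff_one]

namespace LambdaStructure

variable (L : LambdaStructure R)

theorem adams_one_left (r : R) : L.adams 1 r = r := by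
  rw [adams, newtonPsi_one, L.lam_one]

theorem adams_one {n : ℕ} (hn : 0 < n) : L.adams n 1 = 1 := by
  refine Eq.trans ?_ (newtonPsi_unit (R := R) hn)
  refine newtonPsi_congr fun k hk _ => ?_
  rcases Nat.lt_or_ge 1 k with h1 | h1
  · rw [L.lam_apply_one k h1, if_neg h1.not_ge]
  · obtain rfl : k = 1 := by omega
    rw [L.lam_one, if_pos le_rfl]

theorem ext_of_adams [IsAddTorsionFree R] {L L' : LambdaStructure R}
    (h : ∀ n, 0 < n → ∀ r, L.adams n r = L'.adams n r) : L = L' := by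
  ext i r
  exact eq_of_newtonPsi_eq (e := fun i => L.lam i r) (f := fun i => L'.lam i r)
    (by rw [L.lam_zero, L'.lam_zero]) fun k hk _ => h k hk r

variable [Nontrivial R] [IsAddTorsionFree R]

theorem adams_mul {n : ℕ} (hn : 0 < n) (r s : R) :
    L.adams n (r * s) = L.adams n r * L.adams n s := by
  unfold adams
  rw [← newtonPsi_mulPoly (L.lam_zero r) (L.lam_zero s) hn]
  exact congrArg (newtonPsi · n) (funext fun i => L.lam_mul i r s)

/-- The Adams operation `ψ^n`, for `n ≥ 1`, as a ring endomorphism. -/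
def adamsHom {n : ℕ} (hn : 0 < n) : R →+* R :=
  RingHom.mk' ⟨⟨L.adams n, L.adams_one hn⟩, L.adams_mul hn⟩ (L.adams_add n)

/-- Applying the ring endomorphism `ψ^m` to the Newton formula for `ψ^n r` leaves the elements
`ψ^m(λ^j r)`. By the composition axiom these are the elementary symmetric functions of the `ξ_l^m`,
so the `n`-th Newton sum is the power sum of exponent `m n`. -/
theorem adams_adams {m n : ℕ} (hm : 0 < m) (hn : 0 < n) (r : R) :
    L.adams m (L.adams n r) = L.adams (m * n) r := by
  obtain ⟨S, _, _, _, φ, ξ, hφ, hξ⟩ :=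
    exists_coeff_prod_one_add (fun i => L.lam i r) (L.lam_zero r) (m * n)
  apply hφ
  have h1 : L.adams m (L.adams n r) = newtonPsi (fun j => L.adams m (L.lam j r)) n :=
    map_newtonPsi (L.adamsHom hm) _ n
  have h2 : ∀ j ≤ n, φ (L.adams m (L.lam j r)) =
      (∏ l, (1 + C (ξ l ^ m) * X) : S[X]).coeff j := by
    intro j hj
    rw [← newtonPsi_compPoly hξ hm (Nat.mul_le_mul_left m hj), adams, map_newtonPsi]
    simp only [L.lam_lam, map_aeval_int]
  rw [h1, map_newtonPsi, newtonPsi_congr fun j _ hj => h2 j hj, newtonPsi_prod _ _ hn, adams,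
    map_newtonPsi, newtonPsi_of_coeff hξ (Nat.mul_pos hm hn) le_rfl]
  simp only [pow_mul]

/-- A torsion-free ring is a `λ`-ring with Adams operations `Ψ n` as soon as the `Ψ n` are
commuting ring endomorphisms for which the Newton formula can be solved. -/
theorem exists_of_adams (Ψ : ℕ → R →+* R) (h1 : ∀ r, Ψ 1 r = r)
    (hcomp : ∀ m n, 0 < m → 0 < n → ∀ r, Ψ m (Ψ n r) = Ψ (m * n) r)
    (hint : ∀ r, ∃ e : ℕ → R, e 0 = 1 ∧ ∀ n, 0 < n → newtonPsi e n = Ψ n r) :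
    ∃ L : LambdaStructure R, ∀ n, 0 < n → ∀ r, L.adams n r = Ψ n r := by
  choose e he0 he using hint
  have huniq : ∀ (r : R) (f : ℕ → R), f 0 = 1 → (∀ n, 0 < n → newtonPsi f n = Ψ n r) →
      ∀ i, e r i = f i := fun r f hf0 hf i =>
    eq_of_newtonPsi_eq (by rw [he0, hf0]) fun n hn _ => by rw [he r n hn, hf n hn]
  refine ⟨⟨fun i r => e r i, he0, fun r => ?_, fun i hi => ?_, fun i r s => ?_, fun i r s => ?_,
    fun i j r => ?_⟩, fun n hn r => he r n hn⟩
  · rw [← newtonPsi_one (e r), he r 1 one_pos, h1]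
  · rw [huniq 1 (fun i => if i ≤ 1 then 1 else 0) (by simp) (fun n hn => by
      rw [newtonPsi_unit hn, map_one]), if_neg (by omega)]
  · refine huniq (r + s) (fun i => ∑ k ∈ Finset.range (i + 1), e r k * e s (i - k))
      (by simp [he0]) (fun n hn => ?_) i
    rw [newtonPsi_mul (he0 r) (he0 s) fun _ => rfl, he r n hn, he s n hn, map_add]
  · exact eq_aeval_mulPoly (he0 r) (he0 s) (he0 _) i fun n hn _ => by
      rw [he _ n hn, he _ n hn, he _ n hn, map_mul]
  · refine eq_aeval_compPoly (g := fun n k => Ψ n (e r k)) (he0 r) (he0 _)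
      (fun n => by simp [he0]) i j (fun n m hn _ hm _ => ?_) fun n hn _ => he _ n hn
    rw [← map_newtonPsi, he r m hm, hcomp n m hn hm, he r _ (Nat.mul_pos hn hm)]

end LambdaStructure

/-- The elements for which the Newton formula can be solved form a subring. -/
def newtonSubring [Nontrivial R] [IsAddTorsionFree R] (Ψ : ℕ → R →+* R) : Subring R where
  carrier := {r | ∃ e : ℕ → R, e 0 = 1 ∧ ∀ n, 0 < n → newtonPsi e n = Ψ n r}
  one_mem' := ⟨fun i => if i ≤ 1 then 1 else 0, by simp, fun n hn => by
    rw [newtonPsi_unit hn, map_one]⟩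
  zero_mem' := ⟨(1 : R[X]).coeff, by simp, fun n hn => by
    simpa [hn.ne'] using newtonPsi_linear (0 : R) hn⟩
  add_mem' := by
    rintro r s ⟨e, he0, he⟩ ⟨f, hf0, hf⟩
    refine ⟨fun i => ∑ k ∈ Finset.range (i + 1), e k * f (i - k), by simp [he0, hf0],
      fun n hn => ?_⟩
    rw [newtonPsi_mul he0 hf0 fun _ => rfl, he n hn, hf n hn, map_add]
  mul_mem' := by
    rintro r s ⟨e, he0, he⟩ ⟨f, hf0, hf⟩
    refine ⟨fun i => MvPolynomial.aeval (Sum.elim (fun k : Fin i => e (k.val + 1))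
      (fun k : Fin i => f (k.val + 1))) (mulPoly i), ?_, fun n hn => ?_⟩
    -- At index 0 there is no condition on Newton sums, so any sequence starting with 1 will do.
    · exact (eq_aeval_mulPoly he0 hf0 (g := fun _ => 1) rfl 0 fun n hn hn' => by omega).symm
    · rw [newtonPsi_mulPoly he0 hf0 hn, he n hn, hf n hn, map_mul]
  neg_mem' := by
    rintro r ⟨e, he0, he⟩
    -- For `-r` the sequence is given by the inverse power series, whose Newton sums are the
    -- negatives.
    obtain ⟨u, hu⟩ : IsUnit (PowerSeries.mk e) := by
      rw [PowerSeries.isUnit_iff_constantCoeff]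
      simp [← PowerSeries.coeff_zero_eq_constantCoeff_apply, he0]
    have hmul : ∀ i, (1 : R[X]).coeff i = ∑ k ∈ Finset.range (i + 1),
        e k * PowerSeries.coeff (i - k) (↑u⁻¹ : PowerSeries R) := by
      intro i
      have h := congrArg (PowerSeries.coeff i) u.mul_inv
      rw [hu, PowerSeries.coeff_mul, Finset.Nat.sum_antidiagonal_eq_sum_range_succ_mk,
        PowerSeries.coeff_one] at h
      simpa [coeff_one, eq_comm] using h.symm
    have h0 : PowerSeries.coeff 0 (↑u⁻¹ : PowerSeries R) = 1 := by
      simpa [he0] using (hmul 0).symm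
    refine ⟨fun i => PowerSeries.coeff i (↑u⁻¹ : PowerSeries R), h0, fun n hn => ?_⟩
    have h := newtonPsi_mul he0 (f := fun i => PowerSeries.coeff i (↑u⁻¹ : PowerSeries R)) h0 hmul n
    have hz : newtonPsi (1 : R[X]).coeff n = 0 := by
      simpa [hn.ne'] using newtonPsi_linear (0 : R) hn
    rw [hz, he n hn] at h
    rw [map_neg]
    linear_combination -h

end Adams

/-! ### The Adams operations of `S(h, d_2)` -/

/-- The integer `n^2 (n^2 - 1) / 12`. -/
def quadCoeff (n : ℕ) : ℤ := (n + 2).choose 4 + (n + 1).choose 4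

/-- The integer `n^2 (n^2 - 1) (n^2 - 4) / 360`. -/
def cubeCoeff (n : ℕ) : ℤ := (n + 3).choose 6 + (n + 2).choose 6

theorem twelve_mul_quadCoeff (n : ℕ) : 12 * quadCoeff n = (n : ℤ) ^ 2 * ((n : ℤ) ^ 2 - 1) := by
  match n with
  | 0 => rfl
  | 1 => rfl
  | n + 2 =>
    have h1 := Nat.descFactorial_eq_factorial_mul_choose (n + 2 + 2) 4
    have h2 := Nat.descFactorial_eq_factorial_mul_choose (n + 2 + 1) 4
    simp only [Nat.succ_descFactorial_succ, Nat.descFactorial_zero, Nat.descFactorial_one,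
      Nat.factorial] at h1 h2
    zify at h1 h2
    simp only [quadCoeff]
    push_cast at *
    linarith

theorem three_sixty_mul_cubeCoeff (n : ℕ) :
    360 * cubeCoeff n = (n : ℤ) ^ 2 * ((n : ℤ) ^ 2 - 1) * ((n : ℤ) ^ 2 - 4) := by
  match n with
  | 0 => rfl
  | 1 => rfl
  | 2 => rfl
  | n + 3 =>
    have h1 := Nat.descFactorial_eq_factorial_mul_choose (n + 3 + 3) 6
    have h2 := Nat.descFactorial_eq_factorial_mul_choose (n + 3 + 2) 6
    simp only [Nat.succ_descFactorial_succ, Nat.descFactorial_zero, Nat.descFactorial_one,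
      Nat.factorial] at h1 h2
    zify at h1 h2
    simp only [cubeCoeff]
    push_cast at *
    linarith

/-! ### Generating series of the coefficients of `ψ^n(x)` -/

namespace PowerSeries

variable {R : Type*} [CommRing R]

theorem X_pow_mul_mk_one_pow {k d : ℕ} (hk : k ≤ d) :
    (X : PowerSeries R) ^ k * (mk 1) ^ (d + 1) = mk fun i => ((d - k + i).choose d : R) := by
  ext i
  rw [mk_one_pow_eq_mk_choose_add, coeff_X_pow_mul', coeff_mk]
  split_ifs with h
  · rw [coeff_mk, show d + (i - k) = d - k + i by omega]
  · rw [coeff_mk, Nat.choose_eq_zero_of_lt (by omega), Nat.cast_zero]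

theorem derivative_mk_one : derivative R (mk 1) = (mk 1 : PowerSeries R) ^ 2 := by
  have h := mk_one_mul_one_sub_eq_one R
  have h' := congrArg (derivative R) h
  rw [Derivation.leibniz, map_sub, derivative_X, Derivation.map_one_eq_zero, smul_eq_mul,
    smul_eq_mul] at h'
  linear_combination mk 1 * h' - (derivative R (mk 1)) * h

/-- Here `mk 1` is `1/(1-X)`. With `v = X/(1-X)^2`, this series and the next two are `v'`, `v v'`
and `v^2 v'`, which makes the generating series of the `ψ^n(x)` easy to integrate. -/
theorem mk_add_one_sq : (mk fun i => ((i + 1 : ℕ) : R) ^ 2) = (1 + X) * mk 1 ^ 3 := by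
  have h1 := X_pow_mul_mk_one_pow (R := R) (Nat.zero_le 2)
  have h2 := X_pow_mul_mk_one_pow (R := R) (k := 1) (d := 2) (by norm_num)
  rw [show (1 + X) * mk 1 ^ 3 = X ^ 0 * mk 1 ^ 3 + X ^ 1 * (mk 1 : PowerSeries R) ^ 3 by ring,
    h1, h2]
  ext i
  rw [map_add, coeff_mk, coeff_mk, coeff_mk, ← Nat.cast_pow, ← Nat.cast_add]
  congr 1
  rw [show 2 - 0 + i = (i + 1) + 1 by omega, show 2 - 1 + i = i + 1 by omega,
    Nat.choose_succ_succ' (i + 1) 1, Nat.choose_one_right]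
  have h3 := Nat.choose_two_right (i + 1)
  have h4 : 2 ∣ (i + 1) * (i + 1 - 1) := (Nat.even_mul_pred_self _).two_dvd
  rw [h3, Nat.add_sub_cancel] at *
  obtain ⟨c, hc⟩ := h4
  rw [hc, Nat.mul_div_cancel_left _ two_pos]
  linarith

theorem mk_quadCoeff :
    (mk fun i => ((quadCoeff (i + 1) : ℤ) : R)) = X * (1 + X) * mk 1 ^ 5 := by
  have h1 := X_pow_mul_mk_one_pow (R := R) (k := 1) (d := 4) (by norm_num)
  have h2 := X_pow_mul_mk_one_pow (R := R) (k := 2) (d := 4) (by norm_num)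
  rw [show X * (1 + X) * mk 1 ^ 5 = X ^ 1 * mk 1 ^ 5 + X ^ 2 * (mk 1 : PowerSeries R) ^ 5 by ring,
    h1, h2]
  ext i
  rw [map_add, coeff_mk, coeff_mk, coeff_mk, show 4 - 1 + i = i + 1 + 2 by omega,
    show 4 - 2 + i = i + 1 + 1 by omega, quadCoeff]
  push_cast
  rfl

theorem mk_cubeCoeff :
    (mk fun i => ((cubeCoeff (i + 1) : ℤ) : R)) = X ^ 2 * (1 + X) * mk 1 ^ 7 := by
  have h1 := X_pow_mul_mk_one_pow (R := R) (k := 2) (d := 6) (by norm_num)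
  have h2 := X_pow_mul_mk_one_pow (R := R) (k := 3) (d := 6) (by norm_num)
  rw [show X ^ 2 * (1 + X) * mk 1 ^ 7 =
    X ^ 2 * mk 1 ^ 7 + X ^ 3 * (mk 1 : PowerSeries R) ^ 7 by ring, h1, h2]
  ext i
  rw [map_add, coeff_mk, coeff_mk, coeff_mk, show 6 - 2 + i = i + 1 + 3 by omega,
    show 6 - 3 + i = i + 1 + 2 by omega, cubeCoeff]
  push_cast
  rfl

end PowerSeries

/-- The coefficient of `x^3` in `ψ^n(x)`. -/
def adamsCoeff (h d2 : ℤ) (n : ℕ) : ℤ := d2 * quadCoeff n + (6 * d2 + h ^ 2) * cubeCoeff n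

/-- The polynomial `ψ^n(x)`. -/
def adamsPoly {R : Type*} [CommRing R] (h d2 : ℤ) (n : ℕ) (x : R) : R :=
  (n : R) ^ 2 * x + ((h * quadCoeff n : ℤ) : R) * x ^ 2 + (adamsCoeff h d2 n : R) * x ^ 3

/-! ### Solving the Newton formula at `x` -/

section

variable {R : Type*} [CommRing R] {x : R}

-- The generating series of the `ψ^n(x)` is `v'` times a polynomial in `v` and `x`. Integrating in
-- `v` and exponentiating modulo `x^4` gives `λ_{-t}(x)`; the hypotheses on `a, b, c` say that its
-- coefficients are integral.
open PowerSeries in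
theorem exists_newtonPsi_eq_adamsPoly (hx : x ^ 4 = 0) {h d2 a b c : ℤ} (ha : h = 1 - 2 * a)
    (hb : 3 * b = 6 * d2 + h ^ 2 - h + a) (hc : d2 = -2 * c) :
    ∃ e : ℕ → R, e 0 = 1 ∧ ∀ n, 0 < n → newtonPsi e n = adamsPoly h d2 n x := by
  set v : PowerSeries R := PowerSeries.X * mk 1 ^ 2 with hv
  set y : PowerSeries R := PowerSeries.C x with hy
  have hy4 : y ^ 4 = 0 := by rw [hy, ← map_pow, hx, map_zero]
  set P : PowerSeries R := 1 - v * y + (a : PowerSeries R) * v ^ 2 * y ^ 2 +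
    (-(b : PowerSeries R) * v ^ 3 + (c : PowerSeries R) * v ^ 2) * y ^ 3 with hP
  have hmk : PowerSeries.mk (fun i => (-1) ^ i * ((-1) ^ i * PowerSeries.coeff i P)) = P := by
    ext i
    rw [PowerSeries.coeff_mk, ← mul_assoc, ← mul_pow]
    simp
  have h0 : PowerSeries.coeff 0 P = 1 := by
    simp [hP, hv]
  refine ⟨fun i => (-1) ^ i * PowerSeries.coeff i P, by simpa using h0, fun n hn => ?_⟩
  refine newtonPsi_eq_of_powerSeries (p := fun n => adamsPoly h d2 n x) (by simpa using h0) ?_ hn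
  rw [hmk]
  have hΨ : PowerSeries.mk (fun i => adamsPoly h d2 (i + 1) x) =
      y * (PowerSeries.mk fun i => ((i + 1 : ℕ) : R) ^ 2) +
      y ^ 2 * ((h : PowerSeries R) * PowerSeries.mk fun i => ((quadCoeff (i + 1) : ℤ) : R)) +
      y ^ 3 * ((d2 : PowerSeries R) * (PowerSeries.mk fun i => ((quadCoeff (i + 1) : ℤ) : R)) +
        ((6 * d2 + h ^ 2 : ℤ) : PowerSeries R) *
          PowerSeries.mk fun i => ((cubeCoeff (i + 1) : ℤ) : R)) := by
    ext i
    have hcast : ∀ (m : ℤ) (q : PowerSeries R), PowerSeries.coeff i ((m : PowerSeries R) * q) =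
        m * PowerSeries.coeff i q := fun m q => by
      rw [← map_intCast (PowerSeries.C (R := R)) m, PowerSeries.coeff_C_mul]
    simp only [hy, ← map_pow, map_add, PowerSeries.coeff_C_mul, PowerSeries.coeff_mk, hcast,
      adamsPoly, adamsCoeff]
    push_cast
    ring
  have hw := mk_one_mul_one_sub_eq_one R
  have hdv : PowerSeries.derivative R v = (1 + PowerSeries.X) * mk 1 ^ 3 := by
    rw [hv, Derivation.leibniz, Derivation.leibniz_pow, derivative_mk_one,
      PowerSeries.derivative_X]
    simp only [smul_eq_mul, nsmul_eq_mul]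
    push_cast
    linear_combination -(mk 1 : PowerSeries R) ^ 2 * hw
  have hdy : PowerSeries.derivative R y = 0 := PowerSeries.derivative_C
  have hdP : PowerSeries.derivative R P = PowerSeries.derivative R v * (-y +
      2 * (a : PowerSeries R) * v * y ^ 2 +
      (-3 * (b : PowerSeries R) * v ^ 2 + 2 * (c : PowerSeries R) * v) * y ^ 3) := by
    simp only [hP, map_add, map_sub, Derivation.leibniz, Derivation.leibniz_pow, hdy,
      Derivation.map_one_eq_zero, Derivation.map_intCast, smul_eq_mul, nsmul_eq_mul, map_neg]
    push_cast
    ring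
  rw [hΨ, hdP, mk_add_one_sq, mk_quadCoeff, mk_cubeCoeff,
    show PowerSeries.X * (1 + PowerSeries.X) * mk 1 ^ 5 = PowerSeries.derivative R v * v by
      rw [hdv, hv]; ring,
    show PowerSeries.X ^ 2 * (1 + PowerSeries.X) * mk 1 ^ 7 = PowerSeries.derivative R v * v ^ 2 by
      rw [hdv, hv]; ring, ← hdv]
  have ha' : (h : PowerSeries R) = 1 - 2 * a := by exact_mod_cast congrArg (Int.cast) ha
  have hb' : (3 * b : PowerSeries R) = 6 * d2 + h ^ 2 - h + a := by
    exact_mod_cast congrArg (Int.cast) hb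
  have hc' : (d2 : PowerSeries R) = -2 * c := by exact_mod_cast congrArg (Int.cast) hc
  push_cast
  rw [hP]
  generalize PowerSeries.derivative R v = w
  -- The three relations match the terms in `y^2` and `y^3`; everything of higher order is a
  -- multiple of `y^4`.
  linear_combination w * v * y ^ 2 * ha' + w * v * y ^ 3 * hc' - w * v ^ 2 * y ^ 3 * hb' +
    (-v * (d2 * (w * v) + (6 * d2 + h ^ 2) * (w * v ^ 2)) + a * v ^ 2 * (h * (w * v)) +
      (-b * v ^ 3 + c * v ^ 2) * w +
      y * (a * v ^ 2 * (d2 * (w * v) + (6 * d2 + h ^ 2) * (w * v ^ 2)) +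
        (-b * v ^ 3 + c * v ^ 2) * (h * (w * v))) +
      y ^ 2 * ((-b * v ^ 3 + c * v ^ 2) *
        (d2 * (w * v) + (6 * d2 + h ^ 2) * (w * v ^ 2)))) * hy4

end

/-! ### The `λ`-rings `S(h, d_2)` -/

section

variable {R : Type*} [CommRing R] {x : R}

theorem adamsPoly_one (h d2 : ℤ) (x : R) : adamsPoly h d2 1 x = x := by
  have h1 : quadCoeff 1 = 0 := rfl
  have h2 : cubeCoeff 1 = 0 := rfl
  simp [adamsPoly, adamsCoeff, h1, h2]

theorem map_adamsPoly {S : Type*} [CommRing S] (φ : R →+* S) (h d2 : ℤ) (n : ℕ) (x : R) :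
    φ (adamsPoly h d2 n x) = adamsPoly h d2 n (φ x) := by
  simp [adamsPoly]

theorem quadCoeff_mul (m n : ℕ) :
    quadCoeff (m * n) = (n : ℤ) ^ 2 * quadCoeff m + quadCoeff n * (m : ℤ) ^ 4 := by
  have h1 := twelve_mul_quadCoeff (m * n)
  have h2 := twelve_mul_quadCoeff m
  have h3 := twelve_mul_quadCoeff n
  push_cast at h1
  apply mul_left_cancel₀ (show (12 : ℤ) ≠ 0 by norm_num)
  linear_combination h1 - n ^ 2 * h2 - m ^ 4 * h3

/-- This is the `x^3`-coefficient of the relation `ψ^m ψ^n = ψ^{mn}`, as `quadCoeff_mul` is its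
`x^2`-coefficient up to the factor `h`. -/
theorem adamsCoeff_mul (h d2 : ℤ) (m n : ℕ) :
    adamsCoeff h d2 (m * n) = (n : ℤ) ^ 2 * adamsCoeff h d2 m +
      2 * (m : ℤ) ^ 2 * (h * quadCoeff m) * (h * quadCoeff n) +
        adamsCoeff h d2 n * (m : ℤ) ^ 6 := by
  have h1 := twelve_mul_quadCoeff (m * n)
  have h2 := twelve_mul_quadCoeff m
  have h3 := twelve_mul_quadCoeff n
  have k1 := three_sixty_mul_cubeCoeff (m * n)
  have k2 := three_sixty_mul_cubeCoeff m
  have k3 := three_sixty_mul_cubeCoeff n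
  push_cast at h1 k1
  apply mul_left_cancel₀ (show (360 : ℤ) ≠ 0 by norm_num)
  simp only [adamsCoeff]
  linear_combination 30 * d2 * h1 + (6 * d2 + h ^ 2) * k1 -
    n ^ 2 * (30 * d2 * h2 + (6 * d2 + h ^ 2) * k2) -
    m ^ 6 * (30 * d2 * h3 + (6 * d2 + h ^ 2) * k3) -
    5 * m ^ 2 * h ^ 2 * (12 * quadCoeff n * h2 + (m : ℤ) ^ 2 * ((m : ℤ) ^ 2 - 1) * h3)

theorem adamsPoly_sq (hx : x ^ 4 = 0) (h d2 : ℤ) (n : ℕ) :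
    adamsPoly h d2 n x ^ 2 =
      (n : R) ^ 4 * x ^ 2 + 2 * (n : R) ^ 2 * ((h * quadCoeff n : ℤ) : R) * x ^ 3 := by
  simp only [adamsPoly]
  generalize ((h * quadCoeff n : ℤ) : R) = c
  generalize (adamsCoeff h d2 n : R) = d
  linear_combination (c ^ 2 + 2 * n ^ 2 * d + 2 * c * d * x + d ^ 2 * x ^ 2) * hx

theorem adamsPoly_cube (hx : x ^ 4 = 0) (h d2 : ℤ) (n : ℕ) :
    adamsPoly h d2 n x ^ 3 = (n : R) ^ 6 * x ^ 3 := by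
  rw [pow_succ, adamsPoly_sq hx]
  simp only [adamsPoly]
  generalize ((h * quadCoeff n : ℤ) : R) = c
  generalize (adamsCoeff h d2 n : R) = d
  linear_combination (n ^ 4 * (c + d * x) + 2 * n ^ 2 * c * (n ^ 2 + c * x + d * x ^ 2)) * hx

theorem adamsPoly_adamsPoly (hx : x ^ 4 = 0) (h d2 : ℤ) (m n : ℕ) :
    adamsPoly h d2 n (adamsPoly h d2 m x) = adamsPoly h d2 (m * n) x := by
  rw [adamsPoly, adamsPoly_sq hx, adamsPoly_cube hx]
  simp only [adamsPoly]
  rw [adamsCoeff_mul, quadCoeff_mul]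
  push_cast
  ring

end

theorem truncX_pow_four : truncX ^ 4 = 0 := by
  have h := AdjoinRoot.eval₂_root (X ^ 4 : ℤ[X])
  rwa [eval₂_X_pow] at h

instance : Nontrivial TruncRing :=
  ⟨⟨truncBasis 0, truncBasis 1, fun h => by simpa using truncBasis.injective h⟩⟩

instance : Module.Free ℤ TruncRing := Module.Free.of_basis truncBasis

instance : IsAddTorsionFree TruncRing := isAddTorsionFree_of_free ℤ TruncRing

theorem TruncRing.ringHom_ext {S : Type*} [CommRing S] {f g : TruncRing →+* S}
    (h : f truncX = g truncX) (r : TruncRing) : f r = g r :=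
  congrArg (fun φ => φ r) (AdjoinRoot.ringHom_ext (RingHom.ext_int _ _) h)

/-- The ring endomorphism of `ℤ[x]/(x^4)` with `x ↦ adamsPoly h d2 n x`. -/
noncomputable def adamsEnd (h d2 : ℤ) (n : ℕ) : TruncRing →+* TruncRing :=
  AdjoinRoot.lift (Int.castRingHom _) (adamsPoly h d2 n truncX) (by
    rw [eval₂_X_pow, pow_succ, adamsPoly_cube truncX_pow_four, adamsPoly]
    linear_combination ((n : TruncRing) ^ 6 * (n ^ 2 + ((h * quadCoeff n : ℤ) : TruncRing) * truncX
      + (adamsCoeff h d2 n : TruncRing) * truncX ^ 2)) * truncX_pow_four)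

@[simp]
theorem adamsEnd_truncX (h d2 : ℤ) (n : ℕ) :
    adamsEnd h d2 n truncX = adamsPoly h d2 n truncX :=
  AdjoinRoot.lift_root _

theorem adamsEnd_one (h d2 : ℤ) (r : TruncRing) : adamsEnd h d2 1 r = r :=
  TruncRing.ringHom_ext (g := RingHom.id _) (by simp [adamsPoly_one]) r

theorem adamsEnd_adamsEnd (h d2 : ℤ) (m n : ℕ) (r : TruncRing) :
    adamsEnd h d2 m (adamsEnd h d2 n r) = adamsEnd h d2 (m * n) r :=
  TruncRing.ringHom_ext (f := (adamsEnd h d2 m).comp (adamsEnd h d2 n))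
    (by simp [map_adamsPoly, adamsPoly_adamsPoly truncX_pow_four]) r

theorem exists_lambdaStructure {h d2 a b c : ℤ} (ha : h = 1 - 2 * a)
    (hb : 3 * b = 6 * d2 + h ^ 2 - h + a) (hc : d2 = -2 * c) :
    ∃ L : LambdaStructure TruncRing, ∀ n, 0 < n → ∀ r, L.adams n r = adamsEnd h d2 n r := by
  refine LambdaStructure.exists_of_adams (adamsEnd h d2) (adamsEnd_one h d2)
    (fun m n _ _ r => adamsEnd_adamsEnd h d2 m n r) fun r => ?_
  obtain ⟨e, he0, he⟩ := exists_newtonPsi_eq_adamsPoly truncX_pow_four ha hb hc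
  have hx : truncX ∈ newtonSubring (adamsEnd h d2) :=
    ⟨e, he0, fun n hn => by rw [he n hn, adamsEnd_truncX]⟩
  change r ∈ newtonSubring (adamsEnd h d2)
  rw [← truncBasis.sum_repr r]
  exact sum_mem fun i _ => zsmul_mem (by rw [truncBasis_apply]; exact pow_mem hx _) _

/-! ### The filtration -/

/-- Each filtration ideal is generated by the single power `x^⌈n/e⌉`; the exponent is capped at 4
because `x^4 = 0`. -/
theorem mem_truncFiltration {e : ℕ} (he : 0 < e) (n : ℕ) (p : ℤ[X]) :
    AdjoinRoot.mk (X ^ 4 : ℤ[X]) p ∈ (truncFiltration e).ideal n ↔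
      X ^ min (n ⌈/⌉ e) 4 ∣ p := by
  have hI : (truncFiltration e).ideal n = Ideal.span {truncX ^ (n ⌈/⌉ e)} := by
    apply le_antisymm
    · refine Ideal.span_le.2 ?_
      rintro _ ⟨k, hk, rfl⟩
      exact Ideal.mem_span_singleton.2 (pow_dvd_pow _ ((ceilDiv_le_iff_le_mul he).2 hk))
    · exact Ideal.span_mono
        (Set.singleton_subset_iff.2 ⟨_, (ceilDiv_le_iff_le_mul he).1 le_rfl, rfl⟩)
  rw [hI, Ideal.mem_span_singleton]
  constructor
  · rintro ⟨q, hq⟩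
    obtain ⟨q, rfl⟩ := AdjoinRoot.mk_surjective q
    have h : AdjoinRoot.mk (X ^ 4 : ℤ[X]) (p - X ^ (n ⌈/⌉ e) * q) = 0 := by
      rw [map_sub, hq, map_mul, map_pow, AdjoinRoot.mk_X, truncX, sub_self]
    rw [AdjoinRoot.mk_eq_zero] at h
    rw [← sub_add_cancel p (X ^ (n ⌈/⌉ e) * q)]
    exact dvd_add ((pow_dvd_pow _ (min_le_right _ _)).trans h)
      ((pow_dvd_pow _ (min_le_left _ _)).mul_right q)
  · rintro ⟨q, rfl⟩
    rw [map_mul, map_pow, AdjoinRoot.mk_X]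
    change truncX ^ _ ∣ truncX ^ _ * _
    rcases le_total (n ⌈/⌉ e) 4 with h | h
    · rw [min_eq_left h]
      exact dvd_mul_right _ _
    · rw [min_eq_right h, truncX_pow_four, zero_mul]
      exact dvd_zero _

theorem mem_truncFiltration_of_natCast_mul {e : ℕ} (he : 0 < e) {n m : ℕ} (hm : m ≠ 0)
    {r : TruncRing} (h : (m : TruncRing) * r ∈ (truncFiltration e).ideal n) :
    r ∈ (truncFiltration e).ideal n := by
  obtain ⟨p, rfl⟩ := AdjoinRoot.mk_surjective r
  rw [← map_natCast (AdjoinRoot.mk (X ^ 4 : ℤ[X])), ← map_mul, mem_truncFiltration he,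
    X_pow_dvd_iff] at h
  rw [mem_truncFiltration he, X_pow_dvd_iff]
  intro d hd
  have := h d hd
  rw [← C_eq_natCast, coeff_C_mul] at this
  simpa [hm] using this

theorem adamsEnd_mem {h d2 : ℤ} {e n m : ℕ} {r : TruncRing}
    (hr : r ∈ (truncFiltration e).ideal n) : adamsEnd h d2 m r ∈ (truncFiltration e).ideal n := by
  have hle : (truncFiltration e).ideal n ≤
      ((truncFiltration e).ideal n).comap (adamsEnd h d2 m) := by
    refine Ideal.span_le.2 ?_
    rintro _ ⟨k, hk, rfl⟩
    change adamsEnd h d2 m (truncX ^ k) ∈ (truncFiltration e).ideal n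
    have : truncX ∣ adamsPoly h d2 m truncX :=
      ⟨m ^ 2 + ((h * quadCoeff m : ℤ) : TruncRing) * truncX +
        (adamsCoeff h d2 m : TruncRing) * truncX ^ 2, by rw [adamsPoly]; ring⟩
    rw [map_pow, adamsEnd_truncX]
    exact Ideal.mem_of_dvd _ (pow_dvd_pow_of_dvd this k) (Ideal.subset_span ⟨k, hk, rfl⟩)
  exact hle hr

/-- The `ψ^n` preserve the ideals because `x` divides `ψ^n(x)`. The Newton formula then puts a
nonzero multiple of `λ^i r` into the ideal, and the quotient is torsion-free. -/
theorem lam_mem_of_adams {h d2 : ℤ} {L : LambdaStructure TruncRing}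
    (hL : ∀ n, 0 < n → ∀ r, L.adams n r = adamsEnd h d2 n r) {e : ℕ} (he : 0 < e) (n i : ℕ)
    (hi : 0 < i) (r : TruncRing) (hr : r ∈ (truncFiltration e).ideal n) :
    L.lam i r ∈ (truncFiltration e).ideal n := by
  induction i using Nat.strong_induction_on with
  | _ i ih =>
    obtain ⟨i, rfl⟩ := Nat.exists_eq_succ_of_ne_zero hi.ne'
    refine mem_truncFiltration_of_natCast_mul he (Nat.succ_ne_zero i) ?_
    have h1 := newtonPsi_succ (fun i => L.lam i r) i
    have h2 : newtonPsi (fun i => L.lam i r) (i + 1) ∈ (truncFiltration e).ideal n := by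
      have := hL (i + 1) i.succ_pos r
      rw [LambdaStructure.adams] at this
      rw [this]
      exact adamsEnd_mem hr
    have h3 : ∑ k : Fin i, (-1) ^ k.val * L.lam (k.val + 1) r *
        newtonPsi (fun i => L.lam i r) (i - k.val) ∈ (truncFiltration e).ideal n :=
      sum_mem fun k _ => Ideal.mul_mem_right _ _
        (Ideal.mul_mem_left _ _ (ih (k.val + 1) (by omega) (by omega)))
    have h4 := Ideal.mul_mem_left _ ((-1) ^ i) (sub_mem h2 h3)
    convert h4 using 1
    rw [h1]
    have hsq : ((-1 : TruncRing) ^ i) * (-1) ^ i = 1 := by rw [← mul_pow]; simp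
    linear_combination (-((i + 1 : ℕ) : TruncRing) * L.lam (i + 1) r) * hsq

/-! ### Comparison with the given Adams operations -/

theorem cast_quadCoeff (n : ℕ) : (quadCoeff n : ℚ) = (n : ℚ) ^ 2 * ((n : ℚ) ^ 2 - 1) / 12 := by
  have h : (12 * quadCoeff n : ℚ) = (n : ℚ) ^ 2 * ((n : ℚ) ^ 2 - 1) := by
    exact_mod_cast congrArg (Int.cast (R := ℚ)) (twelve_mul_quadCoeff n)
  linarith

theorem cast_adamsCoeff (h d2 : ℤ) (p : ℕ) : (adamsCoeff h d2 p : ℚ) = dCoeff h d2 p := by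
  rw [dCoeff]
  split_ifs with hp
  · subst hp
    have h1 : quadCoeff 2 = 1 := rfl
    have h2 : cubeCoeff 2 = 0 := rfl
    simp [adamsCoeff, h1, h2]
  · have h1 : (360 * cubeCoeff p : ℚ) =
        (p : ℚ) ^ 2 * ((p : ℚ) ^ 2 - 1) * ((p : ℚ) ^ 2 - 4) := by
      exact_mod_cast congrArg (Int.cast (R := ℚ)) (three_sixty_mul_cubeCoeff p)
    rw [adamsCoeff]
    push_cast
    rw [cast_quadCoeff]
    linear_combination (6 * d2 + h ^ 2) / 360 * h1

/-- Both families consist of ring endomorphisms, multiplicative in `n`, so agreement at `x` for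
primes suffices. The single formula `adamsCoeff` covers `p = 2` as well, since `cubeCoeff 2 = 0`. -/
theorem isS_iff {h d2 : ℤ} {L : LambdaStructure TruncRing} :
    IsS h d2 L ↔ ∀ n, 0 < n → ∀ r, L.adams n r = adamsEnd h d2 n r := by
  constructor
  · intro hL n
    induction n using induction_on_primes with
    | zero => exact fun h => absurd h (lt_irrefl 0)
    | one => exact fun _ r => by rw [L.adams_one_left, adamsEnd_one]
    | prime_mul p a hp ih =>
      intro hpa r
      have ha : 0 < a := Nat.pos_of_mul_pos_left hpa
      rw [← L.adams_adams hp.pos ha, ih ha, ← adamsEnd_adamsEnd]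
      refine TruncRing.ringHom_ext (f := L.adamsHom hp.pos) ?_ _
      obtain ⟨c, d, hc, hd, hcd⟩ := hL p hp
      have hc' : c = h * quadCoeff p := by
        have : (c : ℚ) = (h * quadCoeff p : ℤ) := by
          rw [hc]
          push_cast
          rw [cast_quadCoeff]
        exact_mod_cast this
      have hd' : d = adamsCoeff h d2 p := by
        rw [← cast_adamsCoeff] at hd
        exact_mod_cast hd
      rw [adamsEnd_truncX, adamsPoly, ← hc', ← hd']
      exact hcd
  · intro hL p hp
    refine ⟨h * quadCoeff p, adamsCoeff h d2 p, ?_, cast_adamsCoeff h d2 p, ?_⟩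
    · push_cast
      rw [cast_quadCoeff]
    · rw [hL p hp.pos, adamsEnd_truncX, adamsPoly]

theorem existsUnique_isS {e : ℕ} (he : 0 < e) {h d2 a b c : ℤ} (ha : h = 1 - 2 * a)
    (hb : 3 * b = 6 * d2 + h ^ 2 - h + a) (hc : d2 = -2 * c) :
    ∃! S : FilteredLambdaStructure TruncRing (truncFiltration e),
      IsS h d2 S.toLambdaStructure := by
  obtain ⟨L, hL⟩ := exists_lambdaStructure ha hb hc
  refine ⟨⟨L, fun n i hi r hr => lam_mem_of_adams hL he n i hi r hr⟩, isS_iff.2 hL, ?_⟩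
  intro S hS
  have h1 : S.toLambdaStructure = L := LambdaStructure.ext_of_adams fun n hn r => by
    rw [isS_iff.1 hS n hn, hL n hn]
  apply FilteredLambdaStructure.ext
  rw [h1]

/-! ### The matrices of the cohomology -/

/-- The matrix of `ψ^n`. -/
def adamsMatrix (h d2 : ℤ) (n : ℕ) : Matrix (Fin 4) (Fin 4) ℤ :=
  !![1, 0, 0, 0;
     0, (n : ℤ) ^ 2, 0, 0;
     0, h * quadCoeff n, (n : ℤ) ^ 4, 0;
     0, adamsCoeff h d2 n, 2 * (n : ℤ) ^ 2 * (h * quadCoeff n), (n : ℤ) ^ 6]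

/-- The integer matrices which commute with all Adams operations. -/
def commutantSet (h d2 : ℤ) : Set (Matrix (Fin 4) (Fin 4) ℤ) :=
  {M | ∃ a j k l r s w : ℤ, M = !![a, 0, 0, 0; 0, j, 0, 0; 0, k, r, 0; 0, l, s, w] ∧
    h * r = h * j + 12 * k ∧ h * w = h * r + 6 * s ∧
    h * s + d2 * w = d2 * j + 8 * h * k + 60 * l}

theorem matrix_four_mul_eq_iff {A B C D : Matrix (Fin 4) (Fin 4) ℤ} :
    A * B = C * D ↔ ∀ i j, A i 0 * B 0 j + A i 1 * B 1 j + A i 2 * B 2 j + A i 3 * B 3 j =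
      C i 0 * D 0 j + C i 1 * D 1 j + C i 2 * D 2 j + C i 3 * D 3 j := by
  simp [← Matrix.ext_iff, Matrix.mul_apply, Fin.sum_univ_four]

section

variable {h d2 : ℤ}

/-- Since the diagonal entries 1, 4, 16, 64 of `ψ^2` are distinct, each off-diagonal entry outside
the displayed shape is forced to vanish; three equations remain below the diagonal. -/
theorem mem_commutantSet_of_commute {M : Matrix (Fin 4) (Fin 4) ℤ}
    (hM : adamsMatrix h d2 2 * M = M * adamsMatrix h d2 2) :
    M ∈ commutantSet h d2 := by
  rw [matrix_four_mul_eq_iff] at hM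
  have q2 : quadCoeff 2 = 1 := rfl
  have c2 : cubeCoeff 2 = 0 := rfl
  have e01 := hM 0 1
  have e02 := hM 0 2
  have e03 := hM 0 3
  have e10 := hM 1 0
  have e12 := hM 1 2
  have e13 := hM 1 3
  have e20 := hM 2 0
  have e21 := hM 2 1
  have e23 := hM 2 3
  have e30 := hM 3 0
  have e31 := hM 3 1
  have e32 := hM 3 2
  simp [adamsMatrix, adamsCoeff, q2, c2] at e01 e02 e03 e10 e12 e13 e20 e21 e23 e30 e31 e32
  -- The elimination starts in the upper right corner, where the equation involves no other unknown.
  have z03 : M 0 3 = 0 := by linarith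
  rw [z03] at e01 e02
  have z02 : M 0 2 = 0 := by linarith
  rw [z02] at e01
  have z01 : M 0 1 = 0 := by linarith
  have z10 : M 1 0 = 0 := by linarith
  have z13 : M 1 3 = 0 := by linarith
  rw [z10] at e20 e30
  rw [z13] at e12 e23
  have z12 : M 1 2 = 0 := by linarith
  have z20 : M 2 0 = 0 := by linarith
  have z23 : M 2 3 = 0 := by linarith
  rw [z12] at e32
  rw [z20] at e30
  rw [z23] at e21
  have z30 : M 3 0 = 0 := by linarith
  refine ⟨M 0 0, M 1 1, M 2 1, M 3 1, M 2 2, M 3 2, M 3 3, ?_, by linarith, by linarith,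
    by linarith⟩
  ext i j
  fin_cases i <;> fin_cases j <;> simp [z01, z02, z03, z10, z12, z13, z20, z23, z30]

theorem adamsMatrix_mul_comm {M : Matrix (Fin 4) (Fin 4) ℤ} (hM : M ∈ commutantSet h d2)
    (h0 : h ≠ 0) (n : ℕ) : adamsMatrix h d2 n * M = M * adamsMatrix h d2 n := by
  obtain ⟨a, j, k, l, r, s, w, rfl, h1, h2, h3⟩ := hM
  have t := twelve_mul_quadCoeff n
  have u := three_sixty_mul_cubeCoeff n
  have e1 : h * quadCoeff n * j + (n : ℤ) ^ 4 * k = k * (n : ℤ) ^ 2 + r * (h * quadCoeff n) := by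
    linear_combination -quadCoeff n * h1 - k * t
  have e2 : 2 * (n : ℤ) ^ 2 * (h * quadCoeff n) * r + (n : ℤ) ^ 6 * s =
      s * (n : ℤ) ^ 4 + w * (2 * (n : ℤ) ^ 2 * (h * quadCoeff n)) := by
    linear_combination -2 * (n : ℤ) ^ 2 * quadCoeff n * h2 - n ^ 2 * s * t
  have e3 : adamsCoeff h d2 n * j + 2 * (n : ℤ) ^ 2 * (h * quadCoeff n) * k + (n : ℤ) ^ 6 * l =
      l * (n : ℤ) ^ 2 + s * (h * quadCoeff n) + w * adamsCoeff h d2 n := by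
    -- Eliminating `s` expresses `w - j` through `k` and `l`; this is what meets the `cubeCoeff`
    -- term of `ψ^n`.
    have h4 : (6 * d2 + h ^ 2) * (h * w - h * j) = h * (60 * h * k + 360 * l) := by
      linear_combination (6 * d2 + h ^ 2) * (h1 + h2) + 6 * h * h3 - 6 * d2 * (h1 + h2)
    have h5 : 60 * cubeCoeff n = 2 * quadCoeff n * ((n : ℤ) ^ 2 - 4) := by
      have : 6 * (60 * cubeCoeff n) = 6 * (2 * quadCoeff n * ((n : ℤ) ^ 2 - 4)) := by
        linear_combination u - ((n : ℤ) ^ 2 - 4) * t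
      linarith
    apply mul_left_cancel₀ h0
    simp only [adamsCoeff]
    linear_combination -h * quadCoeff n * h3 - cubeCoeff n * h4 - h ^ 2 * k * h5 - h * l * u -
      5 * h * l * t
  rw [matrix_four_mul_eq_iff]
  intro i j'
  fin_cases i <;> fin_cases j' <;> simp [adamsMatrix] <;> first | ring1 | linarith

/-- The quantities `r - j`, `w - r`, `w - j` and `s` are fixed rational linear forms in `k`, `l`,
`s`, so the entries of the commutator cancel by antisymmetry once denominators are cleared. -/
theorem commutantSet_mul_comm {M N : Matrix (Fin 4) (Fin 4) ℤ} (hM : M ∈ commutantSet h d2)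
    (hN : N ∈ commutantSet h d2) (h0 : h ≠ 0) (hD : 6 * d2 + h ^ 2 ≠ 0) : M * N = N * M := by
  obtain ⟨a, j, k, l, r, s, w, rfl, h1, h2, h3⟩ := hM
  obtain ⟨a', j', k', l', r', s', w', rfl, h1', h2', h3'⟩ := hN
  have e1 : k * j' + r * k' = k' * j + r' * k := by
    apply mul_left_cancel₀ h0
    linear_combination k' * h1 - k * h1'
  have e2 : s * r' + w * s' = s' * r + w' * s := by
    apply mul_left_cancel₀ h0
    linear_combination s' * h2 - s * h2'
  have e3 : l * j' + s * k' + w * l' = l' * j + s' * k + w' * l := by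
    have p : h * ((6 * d2 + h ^ 2) * (w - j)) = h * (60 * h * k + 360 * l) := by
      linear_combination h ^ 2 * (h1 + h2) + 6 * h * h3
    have p' : h * ((6 * d2 + h ^ 2) * (w' - j')) = h * (60 * h * k' + 360 * l') := by
      linear_combination h ^ 2 * (h1' + h2') + 6 * h * h3'
    have q : (6 * d2 + h ^ 2) * s = (8 * h ^ 2 - 12 * d2) * k + 60 * h * l := by
      linear_combination h * h3 - d2 * (h1 + h2)
    have q' : (6 * d2 + h ^ 2) * s' = (8 * h ^ 2 - 12 * d2) * k' + 60 * h * l' := by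
      linear_combination h * h3' - d2 * (h1' + h2')
    apply mul_left_cancel₀ h0
    apply mul_left_cancel₀ hD
    linear_combination l' * p - l * p' + h * k' * q - h * k * q'
  rw [matrix_four_mul_eq_iff]
  intro i j'
  fin_cases i <;> fin_cases j' <;> simp <;> first | ring1 | linarith

end

/-! ### The cohomology -/

theorem truncRing_repr (y : TruncRing) : ∃ a b c d : ℤ,
    y = a + b * truncX + c * truncX ^ 2 + d * truncX ^ 3 := by
  refine ⟨truncBasis.repr y 0, truncBasis.repr y 1, truncBasis.repr y 2, truncBasis.repr y 3, ?_⟩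
  conv_lhs => rw [← truncBasis.sum_repr y]
  simp [Fin.sum_univ_four, truncBasis_apply]

theorem toMatrix_psi {h d2 : ℤ} {L : LambdaStructure TruncRing} {n : ℕ}
    (hL : ∀ r, L.adams n r = adamsEnd h d2 n r) :
    LinearMap.toMatrixAlgEquiv truncBasis (L.psi n) = adamsMatrix h d2 n := by
  rw [← AlgEquiv.eq_symm_apply, LinearMap.toMatrixAlgEquiv_symm]
  refine truncBasis.ext fun i => ?_
  rw [Matrix.toLinAlgEquiv_self]
  have hpsi : L.psi n (truncBasis i) = adamsPoly h d2 n truncX ^ i.val := by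
    change L.adams n _ = _
    rw [hL, truncBasis_apply, map_pow, adamsEnd_truncX]
  rw [hpsi]
  fin_cases i
  · simp [Fin.sum_univ_four, truncBasis_apply, adamsMatrix]
  · simp [Fin.sum_univ_four, truncBasis_apply, adamsMatrix, adamsPoly]
  · simp [Fin.sum_univ_four, truncBasis_apply, adamsMatrix, adamsPoly_sq truncX_pow_four]
  · simp [Fin.sum_univ_four, truncBasis_apply, adamsMatrix, adamsPoly_cube truncX_pow_four]

theorem prime_dvd_intCast_pow_sub {R : Type*} [CommRing R] {p : ℕ} (hp : p.Prime) (a : ℤ) :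
    (p : R) ∣ (a : R) ^ p - a := by
  have h : (p : ℤ) ∣ a ^ p - a := by
    have := Fact.mk hp
    rw [← ZMod.intCast_zmod_eq_zero_iff_dvd]
    push_cast
    rw [ZMod.pow_card, sub_self]
  obtain ⟨c, hc⟩ := h
  exact ⟨c, by exact_mod_cast congrArg (Int.cast : ℤ → R) hc⟩

theorem prime_dvd_add_pow_sub {R : Type*} [CommRing R] {p : ℕ} (hp : p.Prime) (y z : R) :
    (p : R) ∣ (y + z) ^ p - (y ^ p + z ^ p) := by
  obtain ⟨c, hc⟩ := exists_add_pow_prime_eq hp y z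
  exact ⟨y * z * c, by rw [hc]; ring⟩

/-- Modulo `p` the `p`-th power is additive and fixes integers, and `(x^k)^p = 0` for `k ≥ 2`
because `2 p ≥ 4`. -/
theorem truncRing_pow_prime {p : ℕ} (hp : p.Prime) (a b c d : ℤ) :
    (p : TruncRing) ∣ (a + b * truncX + c * truncX ^ 2 + d * truncX ^ 3) ^ p -
      (a + b * truncX ^ p) := by
  have hz : ∀ k, 2 ≤ k → (truncX ^ k) ^ p = 0 := fun k hk => by
    rw [← pow_mul]
    exact pow_eq_zero_of_le (by nlinarith [hp.two_le]) truncX_pow_four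
  have h1 := prime_dvd_add_pow_sub hp (a + b * truncX + c * truncX ^ 2) (d * truncX ^ 3)
  have h2 := prime_dvd_add_pow_sub hp (a + b * truncX) (c * truncX ^ 2)
  have h3 := prime_dvd_add_pow_sub hp (a : TruncRing) (b * truncX)
  have h4 := prime_dvd_intCast_pow_sub (R := TruncRing) hp a
  have h5 := (prime_dvd_intCast_pow_sub (R := TruncRing) hp b).mul_right (truncX ^ p)
  rw [mul_pow _ (truncX ^ _), hz _ (by norm_num), mul_zero] at h1 h2
  rw [mul_pow] at h3
  convert h1.add (h2.add (h3.add (h4.add h5))) using 1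
  ring

/-- By `truncRing_pow_prime` the condition reduces to `f(x^p) ≡ j x^p` modulo `p`. The three
divisibilities are this congruence for `p = 2` and `p = 3`; for larger `p` both sides vanish. -/
theorem mem_endBar_of_matrix {a j k l r s w : ℤ} {f : Module.End ℤ TruncRing}
    (hf : LinearMap.toMatrixAlgEquiv truncBasis f =
      !![a, 0, 0, 0; 0, j, 0, 0; 0, k, r, 0; 0, l, s, w])
    (hr : 2 ∣ r - j) (hs : 2 ∣ s) (hw : 3 ∣ w - j) : f ∈ endBar TruncRing := by
  have hfb : ∀ i, f (truncBasis i) = ∑ i', (!![a, 0, 0, 0; 0, j, 0, 0; 0, k, r, 0; 0, l, s, w] :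
      Matrix (Fin 4) (Fin 4) ℤ) i' i • truncBasis i' := by
    intro i
    rw [← Matrix.toLinAlgEquiv_self, ← hf, Matrix.toLinAlgEquiv_toMatrixAlgEquiv]
  have f0 : f 1 = a := by
    simpa [Fin.sum_univ_four, truncBasis_apply] using hfb 0
  have f1 : f truncX = j * truncX + k * truncX ^ 2 + l * truncX ^ 3 := by
    simpa [Fin.sum_univ_four, truncBasis_apply] using hfb 1
  have f2 : f (truncX ^ 2) = r * truncX ^ 2 + s * truncX ^ 3 := by
    simpa [Fin.sum_univ_four, truncBasis_apply] using hfb 2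
  have f3 : f (truncX ^ 3) = w * truncX ^ 3 := by
    simpa [Fin.sum_univ_four, truncBasis_apply] using hfb 3
  have hmul : ∀ (m : ℤ) (y : TruncRing), f (m * y) = m * f y := fun m y => by
    rw [← zsmul_eq_mul, map_zsmul, zsmul_eq_mul]
  have hint : ∀ m : ℤ, f m = m * a := fun m => by rw [← mul_one (m : TruncRing), hmul, f0, mul_one]
  intro p hp y
  obtain ⟨b0, b1, b2, b3, rfl⟩ := truncRing_repr y
  obtain ⟨q, hq⟩ := truncRing_pow_prime hp b0 b1 b2 b3
  have hfy : f (b0 + b1 * truncX + b2 * truncX ^ 2 + b3 * truncX ^ 3) =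
      ((b0 * a : ℤ) : TruncRing) + ((b1 * j : ℤ) : TruncRing) * truncX +
        ((b1 * k + b2 * r : ℤ) : TruncRing) * truncX ^ 2 +
          ((b1 * l + b2 * s + b3 * w : ℤ) : TruncRing) * truncX ^ 3 := by
    rw [map_add, map_add, map_add, hint, hmul, hmul, hmul, f1, f2, f3]
    push_cast
    ring
  have hfyp : f ((b0 + b1 * truncX + b2 * truncX ^ 2 + b3 * truncX ^ 3) ^ p) =
      b0 * a + b1 * f (truncX ^ p) + p * f q := by
    rw [sub_eq_iff_eq_add.1 hq, map_add, map_add, hint, hmul, ← nsmul_eq_mul, map_nsmul,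
      nsmul_eq_mul]
    ring
  have hx : (p : TruncRing) ∣ f (truncX ^ p) - j * truncX ^ p := by
    by_cases h4 : 4 ≤ p
    · rw [pow_eq_zero_of_le h4 truncX_pow_four]
      simp
    · have := hp.two_le
      interval_cases p
      · obtain ⟨u, hu⟩ := hr
        obtain ⟨v, rfl⟩ := hs
        obtain rfl : r = j + 2 * u := by linarith
        refine ⟨u * truncX ^ 2 + v * truncX ^ 3, ?_⟩
        rw [f2]
        push_cast
        ring
      · obtain ⟨u, hu⟩ := hw
        obtain rfl : w = j + 3 * u := by linarith
        refine ⟨u * truncX ^ 3, ?_⟩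
        rw [f3]
        push_cast
        ring
  rw [hfyp, hfy]
  convert ((truncRing_pow_prime hp (b0 * a) (b1 * j) (b1 * k + b2 * r)
    (b1 * l + b2 * s + b3 * w)).sub (hx.mul_left b1)).sub (Dvd.intro (f q) rfl) using 1
  push_cast
  ring

section

variable {h d2 : ℤ} {L : LambdaStructure TruncRing}

theorem mem_lambdaCohomologyZero_iff (hh : h = 1 ∨ h = 5) (hd2 : Even d2)
    (hL : ∀ n, 0 < n → ∀ r, L.adams n r = adamsEnd h d2 n r) (f : Module.End ℤ TruncRing) :
    f ∈ lambdaCohomologyZero L ↔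
      LinearMap.toMatrixAlgEquiv truncBasis f ∈ commutantSet h d2 := by
  have h0 : h ≠ 0 := by rcases hh with rfl | rfl <;> norm_num
  have hcomm : ∀ n : ℕ+, (L.psi n * f = f * L.psi n ↔
      adamsMatrix h d2 n * LinearMap.toMatrixAlgEquiv truncBasis f =
        LinearMap.toMatrixAlgEquiv truncBasis f * adamsMatrix h d2 n) := fun n => by
    rw [← toMatrix_psi (hL n n.pos), ← map_mul, ← map_mul, EmbeddingLike.apply_eq_iff_eq]
  constructor
  · rintro ⟨-, hf⟩
    exact mem_commutantSet_of_commute ((hcomm 2).1 (sub_eq_zero.1 (congrFun hf 2)))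
  · intro hf
    refine ⟨?_, funext fun n => sub_eq_zero.2 ((hcomm n).2 (adamsMatrix_mul_comm hf h0 n))⟩
    obtain ⟨a, j, k, l, r, s, w, hM, h1, h2, h3⟩ := hf
    obtain ⟨c, rfl⟩ := hd2
    -- Evenness of `d2` makes `h s` even, hence `s` even as `h` is odd. The other two divisibilities
    -- use that `h` is prime to 6.
    have h3' : h * s = 2 * (c * j - c * w + 4 * h * k + 30 * l) := by linarith
    generalize c * j - c * w + 4 * h * k + 30 * l = z at h3'
    exact mem_endBar_of_matrix hM (by rcases hh with rfl | rfl <;> omega)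
      (by rcases hh with rfl | rfl <;> omega) (by rcases hh with rfl | rfl <;> omega)

theorem free_and_finrank_lambdaCohomologyZero (hh : h = 1 ∨ h = 5) (hd2 : Even d2)
    (hD : 6 * d2 + h ^ 2 ≠ 0) (hL : ∀ n, 0 < n → ∀ r, L.adams n r = adamsEnd h d2 n r) :
    Module.Free ℤ (lambdaCohomologyZero L) ∧
      Module.finrank ℤ (lambdaCohomologyZero L) = 4 := by
  have h0 : h ≠ 0 := by rcases hh with rfl | rfl <;> norm_num
  have hmem := mem_lambdaCohomologyZero_iff hh hd2 hL
  -- The coordinates `a, j, k, l` embed the module into `ℤ^4`, giving freeness and rank at most 4;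
  -- four independent elements give the reverse bound.
  let ev : lambdaCohomologyZero L →ₗ[ℤ] (Fin 4 → ℤ) :=
    (AddMonoidHom.mk' (fun f => ![LinearMap.toMatrixAlgEquiv truncBasis f.1 0 0,
        LinearMap.toMatrixAlgEquiv truncBasis f.1 1 1,
        LinearMap.toMatrixAlgEquiv truncBasis f.1 2 1,
        LinearMap.toMatrixAlgEquiv truncBasis f.1 3 1]) fun f g => by
      ext i
      fin_cases i <;> simp).toIntLinearMap
  have hinj : Function.Injective ev := by
    rw [injective_iff_map_eq_zero]
    intro f hf
    obtain ⟨a, j, k, l, r, s, w, hM, h1, h2, h3⟩ := (hmem f.1).1 f.2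
    have hf' : ![a, j, k, l] = 0 := by simpa [ev, hM] using hf
    obtain rfl : a = 0 := congrFun hf' 0
    obtain rfl : j = 0 := congrFun hf' 1
    obtain rfl : k = 0 := congrFun hf' 2
    obtain rfl : l = 0 := congrFun hf' 3
    obtain rfl : r = 0 := by simpa [h0] using h1
    have hs : (6 * d2 + h ^ 2) * s = 0 := by linear_combination h * h3 - d2 * h2
    obtain rfl : s = 0 := by simpa [hD] using hs
    obtain rfl : w = 0 := by simpa [h0] using h2
    apply Subtype.ext
    apply (LinearMap.toMatrixAlgEquiv truncBasis).injective
    rw [hM]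
    ext i j
    fin_cases i <;> fin_cases j <;> simp
  -- Scaling `k` and `l` by `h (6 d2 + h^2)` clears all denominators in `r`, `s`, `w`.
  have hex : ∀ a j k l : ℤ, ∃ f : lambdaCohomologyZero L,
      ev f = ![a, j, h * (6 * d2 + h ^ 2) * k, h * (6 * d2 + h ^ 2) * l] := by
    intro a j k l
    refine ⟨⟨(LinearMap.toMatrixAlgEquiv truncBasis).symm
      !![a, 0, 0, 0; 0, j, 0, 0; 0, h * (6 * d2 + h ^ 2) * k, j + 12 * (6 * d2 + h ^ 2) * k, 0;
        0, h * (6 * d2 + h ^ 2) * l, h * ((8 * h ^ 2 - 12 * d2) * k + 60 * h * l),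
        j + 12 * (6 * d2 + h ^ 2) * k + 6 * ((8 * h ^ 2 - 12 * d2) * k + 60 * h * l)], ?_⟩, ?_⟩
    · rw [hmem, AlgEquiv.apply_symm_apply]
      exact ⟨_, _, _, _, _, _, _, rfl, by ring, by ring, by ring⟩
    · simp [ev]
  obtain ⟨f0, hf0⟩ := hex 1 0 0 0
  obtain ⟨f1, hf1⟩ := hex 0 1 0 0
  obtain ⟨f2, hf2⟩ := hex 0 0 1 0
  obtain ⟨f3, hf3⟩ := hex 0 0 0 1
  have hli : LinearIndependent ℤ ![f0, f1, f2, f3] := by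
    refine LinearIndependent.of_comp ev (Fintype.linearIndependent_iff.2 fun g hg => ?_)
    have hg' : ∀ i, (g 0 • ev f0 + g 1 • ev f1 + g 2 • ev f2 + g 3 • ev f3) i = 0 := fun i => by
      simpa [Fin.sum_univ_four] using congrFun hg i
    simp only [hf0, hf1, hf2, hf3] at hg'
    intro i
    have := hg' i
    fin_cases i <;> simpa [h0, hD] using this
  have := Module.Finite.of_injective ev hinj
  refine ⟨Module.Free.of_equiv (LinearEquiv.ofInjective ev hinj).symm, ?_⟩
  have hge := hli.fintype_card_le_finrank
  have hle := LinearMap.finrank_le_finrank_of_injective hinj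
  simp at hge hle
  omega

end

theorem theorem6p2 (e : ℕ) (he : 0 < e) (h d2 : ℤ) (hh : h = 1 ∨ h = 5)
    (hd2 : Even d2) (hd2_nonneg : 0 ≤ d2) (hd2_le : d2 ≤ 58) :
    (∃! S : FilteredLambdaStructure TruncRing (truncFiltration e), IsS h d2 S.toLambdaStructure) ∧
    ∀ S : FilteredLambdaStructure TruncRing (truncFiltration e), IsS h d2 S.toLambdaStructure →
      (LinearMap.toMatrixAlgEquiv truncBasis '' (lambdaCohomologyZero S.toLambdaStructure) =
        {M : Matrix (Fin 4) (Fin 4) ℤ | ∃ a j k l r s w : ℤ,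
          M = !![a, 0, 0, 0;
                 0, j, 0, 0;
                 0, k, r, 0;
                 0, l, s, w] ∧
          (h = 1 →
            r = j + 12 * k ∧
            (6 * d2 + 1) * s = (8 - 12 * d2) * k + 60 * l ∧
            w = 6 * s + j + 12 * k) ∧
          (h = 5 →
            k ≡ 0 [ZMOD 5] ∧
            (r : ℚ) = j + 12 * k / 5 ∧
            (6 * d2 + 25) * s = (200 - 12 * d2) * k + 300 * l ∧
            (6 * d2 + 25) * w = (6 * d2 + 25) * j + 300 * k + 360 * l)}) ∧
      (∀ f ∈ lambdaCohomologyZero S.toLambdaStructure,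
        ∀ g ∈ lambdaCohomologyZero S.toLambdaStructure, f * g = g * f) ∧
      Module.Free ℤ (lambdaCohomologyZero S.toLambdaStructure) ∧
      Module.finrank ℤ (lambdaCohomologyZero S.toLambdaStructure) = 4 := by
  have hD : 6 * d2 + h ^ 2 ≠ 0 := by
    rcases hh with rfl | rfl <;> omega
  refine ⟨?_, fun S hS => ?_⟩
  · obtain ⟨c, hc⟩ := hd2
    rcases hh with rfl | rfl
    -- The witnesses are forced: `a = (1 - h)/2`, `b = (6 d2 + h^2 - h + a)/3` and `c = -d2/2`.
    · exact existsUnique_isS he (a := 0) (b := 2 * d2) (c := -c) (by norm_num) (by ring)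
        (by linarith)
    · exact existsUnique_isS he (a := -2) (b := 2 * d2 + 6) (c := -c) (by norm_num) (by ring)
        (by linarith)
  have hL := isS_iff.1 hS
  have hmem := mem_lambdaCohomologyZero_iff hh hd2 hL
  refine ⟨?_, fun f hf g hg => ?_, free_and_finrank_lambdaCohomologyZero hh hd2 hD hL⟩
  · have himage : LinearMap.toMatrixAlgEquiv truncBasis ''
        (lambdaCohomologyZero S.toLambdaStructure) = commutantSet h d2 := by
      ext M
      constructor
      · rintro ⟨f, hf, rfl⟩
        exact (hmem f).1 hf
      · intro hM
        refine ⟨(LinearMap.toMatrixAlgEquiv truncBasis).symm M, (hmem _).2 ?_, ?_⟩ <;>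
          rw [AlgEquiv.apply_symm_apply]
        exact hM
    rw [himage]
    ext M
    refine exists_congr fun a => exists_congr fun j => exists_congr fun k => exists_congr fun l =>
      exists_congr fun r => exists_congr fun s => exists_congr fun w => and_congr_right fun _ => ?_
    rcases hh with rfl | rfl
    · simp only [true_imp_iff, show ((1 : ℤ) = 5) = False by simp, false_imp_iff, and_true]
      constructor
      · rintro ⟨h1, h2, h3⟩
        exact ⟨by linarith, by linear_combination h3 - d2 * (h1 + h2), by linarith⟩
      · rintro ⟨h1, h2, h3⟩
        exact ⟨by linarith, by linarith, by linear_combination h2 + d2 * h3⟩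
    · simp only [true_imp_iff, show ((5 : ℤ) = 1) = False by simp, false_imp_iff, true_and]
      constructor
      · rintro ⟨h1, h2, h3⟩
        refine ⟨Int.modEq_zero_iff_dvd.2 (by omega), ?_,
          by linear_combination 5 * h3 - d2 * (h1 + h2), ?_⟩
        · have h1' : (5 * r : ℚ) = 5 * j + 12 * k := by exact_mod_cast h1
          linarith
        · apply mul_left_cancel₀ (show (5 : ℤ) ≠ 0 by norm_num)
          linear_combination 25 * (h1 + h2) + 30 * h3
      · rintro ⟨-, h1, h2, h3⟩
        have h1' : 5 * r = 5 * j + 12 * k := by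
          have : (5 * r : ℚ) = 5 * j + 12 * k := by linarith
          exact_mod_cast this
        have h4 : 5 * w = 5 * r + 6 * s := by
          -- The stated equations give `5 w = 5 r + 6 s` only after multiplication by `6 d2 + 25`.
          apply mul_left_cancel₀ (show 6 * d2 + 25 ≠ 0 by omega)
          linear_combination 5 * h3 - 6 * h2 - (6 * d2 + 25) * h1'
        refine ⟨h1', h4, ?_⟩
        apply mul_left_cancel₀ (show (5 : ℤ) ≠ 0 by norm_num)
        linear_combination h2 + d2 * (h1' + h4)
  · apply (LinearMap.toMatrixAlgEquiv truncBasis).injective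
    rw [map_mul, map_mul]
    exact commutantSet_mul_comm ((hmem f).1 hf) ((hmem g).1 hg)
      (by rcases hh with rfl | rfl <;> norm_num) hD
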